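/- For every $n\ge 1$ let $Y^1,\dots,Y^n$ be i.i.d. random vectors in $\mathbb R^{p_n}$ with mean $0$, positive definite covariance matrix $\bar\Sigma_n$ and inverse covariance matrix $\bar\Omega_n=\bar\Sigma_n^{-1}=(\bar\omega_{n,ij})$. Let $\bar\omega^o_n=(\bar\omega_{n,ij})_{i<j}$, let $\mathcal A_n=\{(i,j): i<j,\ \bar\omega_{n,ij}\neq 0\}$, $q_n=|\mathcal A_n|$, and $s_n=\min_{(i,j)\in\mathcal A_n}|\bar\omega_{n,ij}|$ (with $s_n=\infty$ and $s_n/(\sqrt{q_n}\lambda_n)=\infty$ if $\mathcal A_n=\emptyset$). Let $\lambda_n$ be real numbers and let $\widehat\alpha_n=(\widehat\alpha_{n,ii})_{i\le p_n}$ be estimates of the diagonal entries, which may be computed from the same data. For $\omega^o\in\mathbb R^{p_n(p_n-1)/2}$ let $Q_{\mathrm{con}}(\omega^o,\widehat\alpha_n)$ be the value of $$Q_{\mathrm{con}}(\Omega)=-\sum_{i=1}^{p_n} n\log\omega_{ii}+\frac12\sum_{i=1}^{p_n}\sum_{k=1}^n\Big(\sum_{j=1}^{p_n}\omega_{ij}Y^k_j\Big)^2+n\lambda_n\sum_{i<j}|\omega_{ij}|$$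 at the symmetric matrix $\Omega$ with off-diagonal entries $\omega^o$ and diagonal entries $\widehat\alpha_n$. For $i<j$ and $t<s$ put $$\bar{\mathcal L}''_{ij,ts}=\bar\Sigma_{n,js}1_{\{i=t\}}+\bar\Sigma_{n,it}1_{\{j=s\}}+\bar\Sigma_{n,is}1_{\{j=t\}}+\bar\Sigma_{n,jt}1_{\{i=s\}}.$$ Assume: (A0) for every $\eta>0$ there is $C_\eta>0$ such that $\max_{i}|\widehat\alpha_{n,ii}-\bar\omega_{n,ii}|\le C_\eta\sqrt{\log n/n}$ with probability at least $1-O(n^{-\eta})$; (A1) there are $0<\lambda_{\min}\le\lambda_{\max}<\infty$ such that for all $n$ the eigenvalues of $\bar\Omega_n$ lie in $[\lambda_{\min},\lambda_{\max}]$; (A2) there is $c>0$ such that $E[e^{x'Y^k}]\le e^{c\,x'\bar\Sigma_n x}$ for all $n$, all $k\le n$ and all $x\in\mathbb R^{p_n}$; and there is $K$ such that for all $n$, $k\le n$ and $j\le p_n$ there is $r>0$ with $E[e^{t(Y^k_j)^2}]<K$ whenever $|t|<r$; (A3) there is $\delta<1$ such that for all $n$ and all $i<j$ with $(i,j)\notin\mathcal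 A_n$, $\big|\bar{\mathcal L}''_{ij,\mathcal A_n}[\bar{\mathcal L}''_{\mathcal A_n,\mathcal A_n}]^{-1}\operatorname{sign}(\bar\omega^o_{\mathcal A_n})\big|\le\delta$. Suppose that $p_n=O(n^\kappa)$ for some $\kappa>0$ and that, as $n\to\infty$, $q_n=o(\sqrt{n/\log n})$, $\sqrt{q_n\log n/n}=o(\lambda_n)$, $\lambda_n\sqrt{n/\log n}\to\infty$, $s_n/(\sqrt{q_n}\lambda_n)\to\infty$ and $\sqrt{q_n}\lambda_n\to0$. Then there is a constant $C>0$ such that for every $\eta>0$, with probability at least $1-O(n^{-\eta})$, the following both hold: there exists a minimizer of $\omega^o\mapsto Q_{\mathrm{con}}(\omega^o,\widehat\alpha_n)$ over $\mathbb R^{p_n(p_n-1)/2}$; and every such minimizer $\widehat\omega^o_n$ satisfies $\|\widehat\omega^o_n-\bar\omega^o_n\|_2\le C\sqrt{q_n}\,\lambda_n$ and $\operatorname{sign}(\widehat\omega_{n,ij})=\operatorname{sign}(\bar\omega_{n,ij})$ for all $1\le i<j\le p_n$. -/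

import Mathlib

open MeasureTheory ProbabilityTheory Filter Topology Asymptotics
open scoped Matrix ENNReal

noncomputable section

namespace Concord

/-- Index set of the off-diagonal entries: pairs `(i, j)` with `i < j`. -/
abbrev Edge (p : ℕ) : Type := {e : Fin p × Fin p // e.1 < e.2}

/-- The vector of (upper) off-diagonal entries of a matrix. -/
def offDiag {p : ℕ} (M : Matrix (Fin p) (Fin p) ℝ) : Edge p → ℝ :=
  fun e => M e.1.1 e.1.2

/-- The symmetric matrix with off-diagonal entries `w` and diagonal entries `d`. -/
def symMatrix {p : ℕ} (w : Edge p → ℝ) (d : Fin p → ℝ) : Matrix (Fin p) (Fin p) ℝ :=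
  fun i j =>
    if h : i < j then w ⟨(i, j), h⟩
    else if h' : j < i then w ⟨(j, i), h'⟩
    else d i

/-- The smooth part of the CONCORD objective for the data `y` (`y k j` is coordinate `j` of
observation `k`):
`- ∑ᵢ n log Mᵢᵢ + (1/2) ∑ᵢ ‖∑ⱼ Mᵢⱼ Yⱼ‖²`, where `Yⱼ = (y k j)ₖ ∈ ℝⁿ`. -/
def Lcon {n p : ℕ} (y : Fin n → Fin p → ℝ) (M : Matrix (Fin p) (Fin p) ℝ) : ℝ :=
  -∑ i, (n : ℝ) * Real.log (M i i) + (1 / 2) * ∑ i, ∑ k, (∑ j, M i j * y k j) ^ 2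

/-- The CONCORD objective with penalty parameter `l`. -/
def Qcon {n p : ℕ} (y : Fin n → Fin p → ℝ) (l : ℝ) (M : Matrix (Fin p) (Fin p) ℝ) : ℝ :=
  Lcon y M + l * ∑ e : Edge p, |offDiag M e|

/-- `w` minimizes the CONCORD objective over all off-diagonal vectors, the diagonal being fixed
at `d`. The normalized penalty level is `l`, i.e. `Qcon / n = Lcon / n + l ∑ |ωᵢⱼ|`. -/
def IsMinimizer {n p : ℕ} (y : Fin n → Fin p → ℝ) (l : ℝ) (d : Fin p → ℝ)
    (w : Edge p → ℝ) : Prop :=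
  ∀ v : Edge p → ℝ,
    Qcon y ((n : ℝ) * l) (symMatrix w d) ≤ Qcon y ((n : ℝ) * l) (symMatrix v d)

open Classical in
/-- The set of nonzero off-diagonal entries. -/
def support {p : ℕ} (M : Matrix (Fin p) (Fin p) ℝ) : Finset (Edge p) :=
  Finset.univ.filter fun e => offDiag M e ≠ 0

/-- The number `q` of nonzero off-diagonal entries. -/
def numEdges {p : ℕ} (M : Matrix (Fin p) (Fin p) ℝ) : ℕ := (support M).card

/-- The smallest absolute value `s` of a nonzero off-diagonal entry (`∞` if there is none). -/
def minSignal {p : ℕ} (M : Matrix (Fin p) (Fin p) ℝ) : ℝ≥0∞ :=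
  ⨅ e ∈ support M, ENNReal.ofReal |offDiag M e|

/-- The entries of the population Hessian (with respect to the off-diagonal entries) of
`Lcon / n`, as a function of the covariance matrix `S`. -/
def popHessian {p : ℕ} (S : Matrix (Fin p) (Fin p) ℝ) (e f : Edge p) : ℝ :=
  (if e.1.1 = f.1.1 then S e.1.2 f.1.2 else 0) + (if e.1.2 = f.1.2 then S e.1.1 f.1.1 else 0) +
  (if e.1.2 = f.1.1 then S e.1.1 f.1.2 else 0) + (if e.1.1 = f.1.2 then S e.1.2 f.1.1 else 0)

open Classical in
/-- `L''_{e,A} [L''_{A,A}]⁻¹ sign(ω_A)` for the precision matrix `M` with support `A`. -/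
def incoherence {p : ℕ} (M : Matrix (Fin p) (Fin p) ℝ) (e : Edge p) : ℝ :=
  (fun f : {f // f ∈ support M} => popHessian M⁻¹ e f.1) ⬝ᵥ
    ((Matrix.of fun f g : {f // f ∈ support M} => popHessian M⁻¹ f.1 g.1)⁻¹ *ᵥ
      fun f => Real.sign (offDiag M f.1))

variable {W : ℕ → Type*} [∀ n, MeasurableSpace (W n)]

/-- The events `E n` hold with probability at least `1 - O(n^{-η})`. It is stated through the
(outer) probability of the complement, so that `E n` need not be known to be measurable. -/
def HighProb (μ : ∀ n, Measure (W n)) (η : ℝ) (E : ∀ n, Set (W n)) : Prop :=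
  (fun n => (μ n).real (E n)ᶜ) =O[atTop] fun n : ℕ => (n : ℝ) ^ (-η)

/-- For every `n`, `Y n 0, …, Y n (n-1)` are i.i.d. random vectors in `ℝ^(p n)` with mean zero and
inverse covariance matrix `Ω n`. -/
structure IsModel (μ : ∀ n, Measure (W n)) (p : ℕ → ℕ)
    (Ω : ∀ n, Matrix (Fin (p n)) (Fin (p n)) ℝ)
    (Y : ∀ n, Fin n → W n → Fin (p n) → ℝ) : Prop where
  posDef : ∀ n, 1 ≤ n → (Ω n).PosDef
  measurable : ∀ n k, Measurable (Y n k)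
  indep : ∀ n, iIndepFun (Y n) (μ n)
  identDistrib : ∀ n k l, IdentDistrib (Y n k) (Y n l) (μ n) (μ n)
  memLp : ∀ n k i, MemLp (fun ξ => Y n k ξ i) 2 (μ n)
  mean : ∀ n k i, ∫ ξ, Y n k ξ i ∂(μ n) = 0
  cov : ∀ n k i j, cov[fun ξ => Y n k ξ i, fun ξ => Y n k ξ j; μ n] = (Ω n)⁻¹ i j

/-- (A0) Accurate diagonal estimates. -/
def AccurateDiagonal (μ : ∀ n, Measure (W n)) (p : ℕ → ℕ)
    (Ω : ∀ n, Matrix (Fin (p n)) (Fin (p n)) ℝ)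
    (α : ∀ n, W n → Fin (p n) → ℝ) : Prop :=
  ∀ η : ℝ, 0 < η → ∃ C : ℝ, 0 < C ∧
    HighProb μ η fun n => {ξ | ∀ i, |α n ξ i - Ω n i i| ≤ C * √(Real.log n / n)}

/-- (A1) Eigenvalues bounded away from zero and infinity, uniformly in `n`. -/
def BoundedEigenvalues (p : ℕ → ℕ) (Ω : ∀ n, Matrix (Fin (p n)) (Fin (p n)) ℝ) : Prop :=
  ∃ lmin lmax : ℝ, 0 < lmin ∧
    ∀ n, 1 ≤ n → ∀ t ∈ spectrum ℝ (Ω n), lmin ≤ t ∧ t ≤ lmax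

/-- (A2) Sub-Gaussianity. -/
def SubGaussian (μ : ∀ n, Measure (W n)) (p : ℕ → ℕ)
    (Ω : ∀ n, Matrix (Fin (p n)) (Fin (p n)) ℝ)
    (Y : ∀ n, Fin n → W n → Fin (p n) → ℝ) : Prop :=
  (∃ c : ℝ, 0 < c ∧ ∀ n (k : Fin n) (x : Fin (p n) → ℝ),
    Integrable (fun ξ => Real.exp (x ⬝ᵥ Y n k ξ)) (μ n) ∧
    ∫ ξ, Real.exp (x ⬝ᵥ Y n k ξ) ∂(μ n) ≤ Real.exp (c * (x ⬝ᵥ ((Ω n)⁻¹ *ᵥ x)))) ∧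
  (∃ K : ℝ, ∀ n (k : Fin n) (j : Fin (p n)), ∃ r : ℝ, 0 < r ∧ ∀ t : ℝ, |t| < r →
    Integrable (fun ξ => Real.exp (t * Y n k ξ j ^ 2)) (μ n) ∧
    ∫ ξ, Real.exp (t * Y n k ξ j ^ 2) ∂(μ n) < K)

/-- (A3) Incoherence. -/
def Incoherent (p : ℕ → ℕ) (Ω : ∀ n, Matrix (Fin (p n)) (Fin (p n)) ℝ) : Prop :=
  ∃ δ : ℝ, δ < 1 ∧ ∀ n, 1 ≤ n → ∀ e, e ∉ support (Ω n) → |incoherence (Ω n) e| ≤ δ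

end Concord

end

/-! With the diagonal fixed, the logarithms are constant, so the objective divided by n is an exact
quadratic in the off-diagonal entries plus an ℓ¹ penalty; its Hessian H is `popHessian` of the
sample covariance S. A point satisfying the KKT conditions, strictly off the true support A and with
positive curvature along A, is therefore the unique minimizer, even when S is singular
(`penalized_lt_of_kkt`).

Such a point is built near the truth (`exists_witness`). Let g be the gradient at the truth, H₀ the
population Hessian, s the true signs and x = √(log n / n). The eigenvalue bounds make H₀ coercive,
and q x → 0 transfers this to H on vectors supported on A, so H u = -l s - g can be solved on A. To
leading order u is -l v₀, where v₀ lives on A and H₀ v₀ = s there; incoherence says |H₀ v₀| ≤ δ < 1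
off A, which leaves room for strict dual feasibility. The remainder r = u + l v₀ solves H r = -g + l
(H - H₀) v₀ on A and has norm O(√q x + l q x) = o(l). This uses that v₀ is deterministic:
concentration along it gives entries of (H - H₀) v₀ of order x ‖v₀‖, while entrywise bounds on H -
H₀ would cost another √q. Hence ‖u‖ = O(√q l), which the minimal signal dominates, so signs are
kept.

Apart from the diagonal estimate, randomness enters only through a'(S - Ω⁻¹)b for polynomially many
fixed pairs (a, b). Products of sub-Gaussian linear forms have exponential moments, so a Chernoff
and union bound suffices (`highProb_sampleCov_dev`). The diagonal estimate enters only through its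
error bound, so it may depend on the same data. -/

namespace Concord

/-! ### Optimality conditions for a penalized quadratic. -/

/-- A point satisfying the KKT conditions of an `ℓ¹`-penalized convex quadratic, strictly off the
set `A`, with a curvature that is positive along `A`, is the strict global minimizer. -/
theorem penalized_lt_of_kkt {ι : Type*} [Fintype ι] (H : Matrix ι ι ℝ)
    (f : (ι → ℝ) → ℝ) (w g : ι → ℝ) (l : ℝ) (A : Finset ι) (hl : 0 < l)
    (hf : ∀ v, f (w + v) = f w + g ⬝ᵥ v + 1 / 2 * (v ⬝ᵥ (H *ᵥ v)))
    (hH : ∀ v, 0 ≤ v ⬝ᵥ (H *ᵥ v))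
    (hpos : ∀ v : ι → ℝ, (∀ e ∉ A, v e = 0) → v ≠ 0 → 0 < v ⬝ᵥ (H *ᵥ v))
    (hA : ∀ e ∈ A, g e = -l * Real.sign (w e) ∧ w e ≠ 0)
    (hAc : ∀ e ∉ A, w e = 0 ∧ |g e| < l) (v : ι → ℝ) (hv : v ≠ 0) :
    f w + l * ∑ e, |w e| < f (w + v) + l * ∑ e, |(w + v) e| := by
  -- Coordinatewise subgradient inequality: -g e is a subgradient of l|·| at w e.
  have key : ∀ e, 0 ≤ g e * v e + l * (|w e + v e| - |w e|) := by
    intro e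
    by_cases he : e ∈ A
    · obtain ⟨h1, h2⟩ := hA e he
      rw [h1]
      rcases lt_or_gt_of_ne h2 with h | h
      · rw [Real.sign_of_neg h, abs_of_neg h]
        nlinarith [neg_abs_le (w e + v e)]
      · rw [Real.sign_of_pos h, abs_of_pos h]
        nlinarith [le_abs_self (w e + v e)]
    · obtain ⟨h1, h2⟩ := hAc e he
      rw [h1, zero_add, abs_zero, sub_zero]
      have := neg_abs_le (g e * v e)
      rw [abs_mul] at this
      nlinarith [abs_nonneg (v e)]
  have hsum : f (w + v) + l * ∑ e, |(w + v) e| - (f w + l * ∑ e, |w e|) =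
      ∑ e, (g e * v e + l * (|w e + v e| - |w e|)) + 1 / 2 * (v ⬝ᵥ (H *ᵥ v)) := by
    rw [hf, Finset.sum_add_distrib, ← Finset.mul_sum, Finset.sum_sub_distrib]
    simp only [dotProduct, Pi.add_apply]
    ring
  suffices 0 < ∑ e, (g e * v e + l * (|w e + v e| - |w e|)) + 1 / 2 * (v ⬝ᵥ (H *ᵥ v)) by
    linarith
  -- Strictness has two sources: curvature when v lives on A, and otherwise the slack |g e| < l at a
  -- coordinate off A.
  by_cases hs : ∀ e ∉ A, v e = 0
  · have := hpos v hs hv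
    have := Finset.sum_nonneg fun e (_ : e ∈ Finset.univ) => key e
    linarith
  · push Not at hs
    obtain ⟨e, he, hve⟩ := hs
    have h1 : 0 < ∑ e, (g e * v e + l * (|w e + v e| - |w e|)) := by
      refine Finset.sum_pos' (fun e _ => key e) ⟨e, Finset.mem_univ e, ?_⟩
      obtain ⟨h1, h2⟩ := hAc e he
      rw [h1, zero_add, abs_zero, sub_zero]
      have := neg_abs_le (g e * v e)
      rw [abs_mul] at this
      nlinarith [abs_pos.mpr hve]
    linarith [hH v]

/-! ### Euclidean norms and linear systems restricted to A. -/

section Norms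

variable {ι : Type*} [Fintype ι]

theorem norm_toLp_sq (v : ι → ℝ) : ‖WithLp.toLp 2 v‖ ^ 2 = ∑ e, v e ^ 2 := by
  simp [EuclideanSpace.norm_sq_eq]

theorem abs_le_norm_toLp (v : ι → ℝ) (e : ι) : |v e| ≤ ‖WithLp.toLp 2 v‖ := by
  simpa using PiLp.norm_apply_le (WithLp.toLp 2 v) e

theorem abs_dotProduct_le_norm (v w : ι → ℝ) :
    |v ⬝ᵥ w| ≤ ‖WithLp.toLp 2 v‖ * ‖WithLp.toLp 2 w‖ := by
  have := abs_real_inner_le_norm (WithLp.toLp 2 w) (WithLp.toLp 2 v)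
  rw [EuclideanSpace.inner_toLp_toLp] at this
  simpa [mul_comm] using this

theorem dotProduct_self_eq_norm_sq (v : ι → ℝ) : v ⬝ᵥ v = ‖WithLp.toLp 2 v‖ ^ 2 := by
  rw [norm_toLp_sq, dotProduct]
  exact Finset.sum_congr rfl fun _ _ => (sq _).symm

/-- The `ℓ¹` norm of a vector supported on `A` is at most `√|A|` times its `ℓ²` norm. -/
theorem sum_abs_le_sqrt_card_mul_norm (A : Finset ι) (v : ι → ℝ) :
    ∑ e ∈ A, |v e| ≤ √(A.card : ℝ) * ‖WithLp.toLp 2 v‖ := by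
  have h := sq_sum_le_card_mul_sum_sq (s := A) (f := fun e => |v e|)
  have h2 : ∑ e ∈ A, |v e| ^ 2 ≤ ‖WithLp.toLp 2 v‖ ^ 2 := by
    rw [norm_toLp_sq]
    simp only [sq_abs]
    exact Finset.sum_le_sum_of_subset_of_nonneg (Finset.subset_univ _) fun _ _ _ => sq_nonneg _
  refine abs_le_of_sq_le_sq' ?_ (by positivity) |>.2
  rw [mul_pow, Real.sq_sqrt (by positivity)]
  exact h.trans (by gcongr)

theorem abs_dotProduct_le_of_support (A : Finset ι) (b v : ι → ℝ) (c : ℝ)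
    (hv : ∀ e ∉ A, v e = 0) (hb : ∀ e ∈ A, |b e| ≤ c) :
    |b ⬝ᵥ v| ≤ c * (√(A.card : ℝ) * ‖WithLp.toLp 2 v‖) := by
  -- Only a nonempty A forces c ≥ 0.
  rcases A.eq_empty_or_nonempty with rfl | ⟨e₀, he₀⟩
  · have : v = 0 := funext fun e => hv e (by simp)
    simp [this]
  have hc : 0 ≤ c := (abs_nonneg _).trans (hb e₀ he₀)
  have h1 : b ⬝ᵥ v = ∑ e ∈ A, b e * v e := by
    rw [dotProduct]
    exact (Finset.sum_subset (Finset.subset_univ A) fun e _ he => by simp [hv e he]).symm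
  rw [h1]
  calc |∑ e ∈ A, b e * v e| ≤ ∑ e ∈ A, |b e * v e| := Finset.abs_sum_le_sum_abs _ _
    _ ≤ ∑ e ∈ A, c * |v e| := Finset.sum_le_sum fun e he => by
        rw [abs_mul]; exact mul_le_mul_of_nonneg_right (hb e he) (abs_nonneg _)
    _ = c * ∑ e ∈ A, |v e| := by rw [Finset.mul_sum]
    _ ≤ _ := mul_le_mul_of_nonneg_left (sum_abs_le_sqrt_card_mul_norm A v) hc

/-- If `H` is coercive along `A` then a solution of `H v = b` on `A` is controlled by `b`. -/
theorem norm_le_of_coercive (A : Finset ι) (H : Matrix ι ι ℝ) (m c : ℝ) (hm : 0 < m)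
    (v : ι → ℝ) (hv : ∀ e ∉ A, v e = 0)
    (hH : m * ‖WithLp.toLp 2 v‖ ^ 2 ≤ v ⬝ᵥ (H *ᵥ v))
    (hb : ∀ e ∈ A, |(H *ᵥ v) e| ≤ c) :
    ‖WithLp.toLp 2 v‖ ≤ c * √(A.card : ℝ) / m := by
  have h := abs_dotProduct_le_of_support A (H *ᵥ v) v c hv hb
  rw [dotProduct_comm] at h
  have h2 := hH.trans ((le_abs_self _).trans h)
  rcases (norm_nonneg (WithLp.toLp 2 v)).eq_or_lt with h0 | h0
  · rw [← h0]
    rcases A.eq_empty_or_nonempty with rfl | ⟨e₀, he₀⟩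
    · simp
    have hc : 0 ≤ c := (abs_nonneg _).trans (hb e₀ he₀)
    positivity
  rw [le_div_iff₀ hm]
  nlinarith

/-- A matrix that is coercive along `A` can be solved along `A`. -/
theorem exists_solution_of_coercive (A : Finset ι) (H : Matrix ι ι ℝ)
    (hH : ∀ v : ι → ℝ, (∀ e ∉ A, v e = 0) → v ≠ 0 → 0 < v ⬝ᵥ (H *ᵥ v)) (b : ι → ℝ) :
    ∃ v : ι → ℝ, (∀ e ∉ A, v e = 0) ∧ ∀ e ∈ A, (H *ᵥ v) e = b e := by
  classical
  let φ : (A → ℝ) → (ι → ℝ) := fun v e => if h : e ∈ A then v ⟨e, h⟩ else 0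
  have hφA : ∀ v e, e ∉ A → φ v e = 0 := fun v e he => by simp [φ, he]
  have hφ : ∀ v (e : A), φ v e = v e := fun v e => by simp [φ]
  let K : Matrix A A ℝ := H.submatrix (↑) (↑)
  have hK : ∀ v (e : A), (K *ᵥ v) e = (H *ᵥ φ v) e := by
    intro v e
    simp only [Matrix.mulVec, dotProduct, K, Matrix.submatrix_apply]
    rw [← Finset.sum_subset (Finset.subset_univ A) fun f _ hf => by simp [hφA v f hf],
      ← Finset.sum_coe_sort A]
    simp [hφ]
  -- A kernel vector of the principal block, extended by zero, would have vanishing quadratic form.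
  have hinj : Function.Injective (Matrix.mulVecLin K) := by
    rw [← LinearMap.ker_eq_bot, LinearMap.ker_eq_bot']
    intro v hv
    by_contra hne
    have h1 : φ v ≠ 0 := fun h => hne (funext fun e => by rw [← hφ v e, h]; rfl)
    have h2 := hH _ (hφA v) h1
    have h3 : φ v ⬝ᵥ (H *ᵥ φ v) = 0 := by
      refine Finset.sum_eq_zero fun e _ => ?_
      by_cases he : e ∈ A
      · have := congrFun hv ⟨e, he⟩
        rw [Matrix.mulVecLin_apply, hK] at this
        simp only [Pi.zero_apply] at this
        rw [this, mul_zero]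
      · rw [hφA v e he, zero_mul]
    exact h2.ne' h3
  obtain ⟨v, hv⟩ := (LinearMap.injective_iff_surjective.mp hinj) fun e => b e
  refine ⟨φ v, hφA v, fun e he => ?_⟩
  rw [← hK v ⟨e, he⟩]
  exact congrFun hv ⟨e, he⟩

end Norms

/-! ### Primal-dual witness. -/

/-- Construction of the primal-dual witness for a perturbation `H` of the population Hessian `H₀`:
`g` is the gradient at the truth, `s` the sign vector, `v₀` the population direction. -/
theorem exists_witness {ι : Type*} [Fintype ι] (A : Finset ι) (H₀ H : Matrix ι ι ℝ)
    (g s v₀ : ι → ℝ) (m R γ ε δ l : ℝ) (hm : 0 < m) (hR : 0 ≤ R) (hε : 0 ≤ ε)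
    (hl : 0 < l)
    (hcoer : ∀ v, m * ‖WithLp.toLp 2 v‖ ^ 2 ≤ v ⬝ᵥ (H₀ *ᵥ v))
    (hrow : ∀ v e, |(H₀ *ᵥ v) e| ≤ R * ‖WithLp.toLp 2 v‖)
    (hE : ∀ e f, |(H - H₀) e f| ≤ ε) (hg : ∀ e, |g e| ≤ γ) (hs : ∀ e, |s e| ≤ 1)
    (hv₀ : ∀ e ∉ A, v₀ e = 0) (hv₀A : ∀ e ∈ A, (H₀ *ᵥ v₀) e = s e)
    (hv₀Ac : ∀ e ∉ A, |(H₀ *ᵥ v₀) e| ≤ δ)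
    (hEv : ∀ e, |((H - H₀) *ᵥ v₀) e| ≤ ε * ‖WithLp.toLp 2 v₀‖)
    (hsmall : (A.card : ℝ) * ε ≤ m / 2) (ρ : ℝ)
    (hρ : 2 / m * (√(A.card : ℝ) * γ + l * (A.card * ε) / m) ≤ ρ)
    (hdual : γ + l * δ + l * (√(A.card : ℝ) * ε / m) + (R + √(A.card : ℝ) * ε) * ρ < l) :
    (∀ v : ι → ℝ, (∀ e ∉ A, v e = 0) → v ≠ 0 → 0 < v ⬝ᵥ (H *ᵥ v)) ∧
    ∃ u : ι → ℝ, (∀ e ∉ A, u e = 0) ∧ (∀ e ∈ A, (g + H *ᵥ u) e = -l * s e) ∧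
      (∀ e ∉ A, |(g + H *ᵥ u) e| < l) ∧
      ‖WithLp.toLp 2 u‖ ≤ l * (√(A.card : ℝ) / m) + ρ := by
  set q : ℝ := (A.card : ℝ) with hq
  have hq0 : 0 ≤ q := by positivity
  have hHE : ∀ v, H *ᵥ v = H₀ *ᵥ v + (H - H₀) *ᵥ v := fun v => by
    rw [← Matrix.add_mulVec]; simp
  have hErow : ∀ v : ι → ℝ, (∀ e ∉ A, v e = 0) → ∀ e,
      |((H - H₀) *ᵥ v) e| ≤ ε * (√q * ‖WithLp.toLp 2 v‖) := fun v hv e =>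
    abs_dotProduct_le_of_support A _ v ε hv fun f _ => hE e f
  -- On vectors supported on A the perturbation moves the form by at most q ε ‖v‖², half of the
  -- coercivity.
  have hcoer' : ∀ v : ι → ℝ, (∀ e ∉ A, v e = 0) →
      m / 2 * ‖WithLp.toLp 2 v‖ ^ 2 ≤ v ⬝ᵥ (H *ᵥ v) := by
    intro v hv
    have h1 := abs_dotProduct_le_of_support A _ v _ hv fun e _ => hErow v hv e
    rw [dotProduct_comm] at h1
    have h2 := hcoer v
    rw [hHE, dotProduct_add]
    have h3 : ε * (√q * ‖WithLp.toLp 2 v‖) * (√q * ‖WithLp.toLp 2 v‖) =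
        q * ε * ‖WithLp.toLp 2 v‖ ^ 2 := by
      linear_combination ε * ‖WithLp.toLp 2 v‖ ^ 2 * Real.mul_self_sqrt hq0
    rw [h3] at h1
    nlinarith [neg_abs_le (v ⬝ᵥ ((H - H₀) *ᵥ v)), sq_nonneg ‖WithLp.toLp 2 v‖]
  have hpos : ∀ v : ι → ℝ, (∀ e ∉ A, v e = 0) → v ≠ 0 → 0 < v ⬝ᵥ (H *ᵥ v) := by
    intro v hv hne
    have : 0 < ‖WithLp.toLp 2 v‖ := by
      rw [norm_pos_iff]; simpa using hne
    exact lt_of_lt_of_le (by positivity) (hcoer' v hv)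
  refine ⟨hpos, ?_⟩
  obtain ⟨u, hu, huA⟩ := exists_solution_of_coercive A H hpos (fun e => -l * s e - g e)
  have hnv₀ : ‖WithLp.toLp 2 v₀‖ ≤ √q / m := by
    have := norm_le_of_coercive A H₀ m 1 hm v₀ hv₀ (hcoer v₀)
      fun e he => by rw [hv₀A e he]; exact hs e
    simpa using this
  -- The deviation of u from its population value -l v₀; the sign terms cancel in H r along A.
  set r := u + l • v₀ with hr
  have hur : u = r - l • v₀ := by rw [hr]; abel
  have hr0 : ∀ e ∉ A, r e = 0 := fun e he => by simp [hr, hu e he, hv₀ e he]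
  have hHr : ∀ e ∈ A, (H *ᵥ r) e = - g e + l * ((H - H₀) *ᵥ v₀) e := by
    intro e he
    rw [hr, Matrix.mulVec_add, Matrix.mulVec_smul, Pi.add_apply, huA e he, hHE v₀]
    simp only [Pi.smul_apply, Pi.add_apply, smul_eq_mul, hv₀A e he]
    ring
  -- `hEv`, not `hErow`: the fixed direction v₀ saves a factor √q.
  have hEv' : ∀ e, |l * ((H - H₀) *ᵥ v₀) e| ≤ l * (ε * (√q / m)) := fun e => by
    rw [abs_mul, abs_of_pos hl]
    gcongr
    exact (hEv e).trans (by gcongr)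
  have hnr : ‖WithLp.toLp 2 r‖ ≤ ρ := by
    refine (norm_le_of_coercive A H (m / 2) (γ + l * (ε * (√q / m))) (by positivity) r hr0
      (hcoer' r hr0) fun e he => ?_).trans (le_trans (le_of_eq ?_) hρ)
    · rw [hHr e he]
      refine (abs_add_le _ _).trans (add_le_add ?_ (hEv' e))
      rw [abs_neg]; exact hg e
    · rw [← hq]
      field_simp
      linear_combination l * ε * Real.mul_self_sqrt hq0
  refine ⟨u, hu, fun e he => by rw [Pi.add_apply, huA e he]; ring, fun e he => ?_, ?_⟩
  · have h1 : (g + H *ᵥ u) e = g e + (H₀ *ᵥ r) e + ((H - H₀) *ᵥ r) e - l * (H₀ *ᵥ v₀) e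
        - l * ((H - H₀) *ᵥ v₀) e := by
      rw [hur, Matrix.mulVec_sub, Matrix.mulVec_smul, hHE, hHE]
      simp only [Pi.add_apply, Pi.sub_apply, Pi.smul_apply, smul_eq_mul]
      ring
    have h2 : |l * (H₀ *ᵥ v₀) e| ≤ l * δ := by
      rw [abs_mul, abs_of_pos hl]
      exact mul_le_mul_of_nonneg_left (hv₀Ac e he) hl.le
    have h3 : |(H₀ *ᵥ r) e| ≤ R * ρ := (hrow r e).trans (by gcongr)
    have h4 : |((H - H₀) *ᵥ r) e| ≤ ε * (√q * ρ) := (hErow r hr0 e).trans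
      (mul_le_mul_of_nonneg_left (mul_le_mul_of_nonneg_left hnr (Real.sqrt_nonneg q)) hε)
    have h5 := hEv' e
    have h6 := hg e
    have h7 : l * (ε * (√q / m)) = l * (√q * ε / m) := by ring
    rw [h7] at h5
    rw [h1]
    rw [abs_le] at h2 h3 h4 h5 h6
    rw [abs_lt]
    constructor <;> nlinarith
  · rw [hur]
    calc ‖WithLp.toLp 2 (r - l • v₀)‖ = ‖WithLp.toLp 2 r - l • WithLp.toLp 2 v₀‖ := rfl
      _ ≤ ‖WithLp.toLp 2 r‖ + ‖l • WithLp.toLp 2 v₀‖ := norm_sub_le _ _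
      _ = ‖WithLp.toLp 2 r‖ + l * ‖WithLp.toLp 2 v₀‖ := by
        rw [norm_smul, Real.norm_of_nonneg hl.le]
      _ ≤ ρ + l * (√q / m) := by gcongr
      _ = _ := add_comm _ _

/-! ### Gradient and Hessian of the objective. -/

section Algebra

variable {p : ℕ}

theorem symMatrix_symm (w : Edge p → ℝ) (d : Fin p → ℝ) (i j : Fin p) :
    symMatrix w d i j = symMatrix w d j i := by
  rcases lt_trichotomy i j with h | rfl | h
  · simp [symMatrix, h, h.not_gt]
  · rfl
  · simp [symMatrix, h, h.not_gt]

theorem symMatrix_edge (w : Edge p → ℝ) (d : Fin p → ℝ) (e : Edge p) :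
    symMatrix w d e.1.1 e.1.2 = w e := by
  simp [symMatrix, e.2]

theorem symMatrix_diag (w : Edge p → ℝ) (d : Fin p → ℝ) (i : Fin p) :
    symMatrix w d i i = d i := by
  simp [symMatrix]

theorem offDiag_symMatrix (w : Edge p → ℝ) (d : Fin p → ℝ) : offDiag (symMatrix w d) = w :=
  funext (symMatrix_edge w d)

theorem symMatrix_add (w v : Edge p → ℝ) (d : Fin p → ℝ) :
    symMatrix (w + v) d = symMatrix w d + symMatrix v 0 := by
  ext i j
  simp only [symMatrix, Matrix.add_apply]
  split_ifs <;> simp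

theorem eq_symMatrix_add_diagonal {M : Matrix (Fin p) (Fin p) ℝ} (hM : Mᵀ = M)
    (d : Fin p → ℝ) :
    symMatrix (offDiag M) d = M + Matrix.diagonal fun i => d i - M i i := by
  ext i j
  rcases lt_trichotomy i j with h | rfl | h
  · simp [symMatrix, h, h.ne, offDiag]
  · simp [symMatrix]
  · simp [symMatrix, h, h.ne', h.not_gt, offDiag]
    exact congrFun (congrFun hM i) j

/-- Each edge occurs at (i, j) and at (j, i). This is the passage from matrix sums to edge sums
behind the gradient, Hessian and norm identities below. -/
theorem sum_symMatrix_mul (u : Edge p → ℝ) (N : Matrix (Fin p) (Fin p) ℝ) :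
    ∑ i, ∑ j, symMatrix u 0 i j * N i j = ∑ e : Edge p, u e * (N e.1.1 e.1.2 + N e.1.2 e.1.1) := by
  have h1 : ∀ F : Fin p → Fin p → ℝ,
      ∑ e : Edge p, F e.1.1 e.1.2 = ∑ i, ∑ j, if i < j then F i j else 0 := by
    intro F
    rw [← Fintype.sum_prod_type' (f := fun i j => if i < j then F i j else 0),
      ← Finset.sum_filter, ← Finset.sum_subtype_eq_sum_filter]
    simp
  have h2 : ∀ e : Edge p, u e * (N e.1.1 e.1.2 + N e.1.2 e.1.1) =
      (fun i j => symMatrix u 0 i j * (N i j + N j i)) e.1.1 e.1.2 := fun e => by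
    simp only [symMatrix_edge]
  rw [Finset.sum_congr rfl fun e _ => h2 e, h1 fun i j => symMatrix u 0 i j * (N i j + N j i)]
  have h3 : ∑ i, ∑ j, (if i < j then symMatrix u 0 i j * (N i j + N j i) else 0) =
      (∑ i, ∑ j, if i < j then symMatrix u 0 i j * N i j else 0) +
      ∑ i, ∑ j, if j < i then symMatrix u 0 i j * N i j else 0 := by
    rw [Finset.sum_comm (f := fun i j => if j < i then symMatrix u 0 i j * N i j else 0),
      ← Finset.sum_add_distrib]
    refine Finset.sum_congr rfl fun i _ => ?_
    rw [← Finset.sum_add_distrib]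
    refine Finset.sum_congr rfl fun j _ => ?_
    split_ifs
    · rw [symMatrix_symm u 0 j i]; ring
    · simp
  rw [h3, ← Finset.sum_add_distrib]
  refine Finset.sum_congr rfl fun i _ => ?_
  rw [← Finset.sum_add_distrib]
  refine Finset.sum_congr rfl fun j _ => ?_
  rcases lt_trichotomy i j with h | rfl | h
  · simp [h, h.not_gt]
  · simp [symMatrix]
  · simp [h, h.not_gt]

/-- The gradient of `½ tr (M S M)` with respect to the off-diagonal entries. -/
noncomputable def quadGrad (S M : Matrix (Fin p) (Fin p) ℝ) (e : Edge p) : ℝ :=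
  (M * S) e.1.1 e.1.2 + (M * S) e.1.2 e.1.1

theorem popHessian_mulVec (S : Matrix (Fin p) (Fin p) ℝ) (hS : Sᵀ = S) (u : Edge p → ℝ)
    (e : Edge p) :
    (Matrix.of (popHessian S) *ᵥ u) e = quadGrad S (symMatrix u 0) e := by
  have hS' : ∀ i j, S i j = S j i := fun i j => congrFun (congrFun hS j) i
  have h1 : quadGrad S (symMatrix u 0) e = ∑ i, ∑ j, symMatrix u 0 i j *
      ((if i = e.1.1 then S j e.1.2 else 0) + if i = e.1.2 then S j e.1.1 else 0) := by
    simp only [mul_add, Finset.sum_add_distrib, quadGrad, Matrix.mul_apply, mul_ite, mul_zero]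
    congr 1
    · symm
      rw [Finset.sum_eq_single e.1.1] <;> simp +contextual
    · symm
      rw [Finset.sum_eq_single e.1.2] <;> simp +contextual
  rw [h1, sum_symMatrix_mul u fun i j =>
    (if i = e.1.1 then S j e.1.2 else 0) + if i = e.1.2 then S j e.1.1 else 0]
  simp only [Matrix.mulVec, dotProduct, Matrix.of_apply]
  refine Finset.sum_congr rfl fun f _ => ?_
  rw [mul_comm, popHessian, hS' f.1.2 e.1.2, hS' f.1.2 e.1.1, hS' f.1.1 e.1.2, hS' f.1.1 e.1.1]
  simp only [eq_comm (a := e.1.1), eq_comm (a := e.1.2)]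
  ring

/-- The form splits over rows, so positivity and coercivity in edge space follow from those of S. -/
theorem popHessian_quadratic (S : Matrix (Fin p) (Fin p) ℝ) (hS : Sᵀ = S) (u : Edge p → ℝ) :
    u ⬝ᵥ (Matrix.of (popHessian S) *ᵥ u) =
      ∑ i, symMatrix u 0 i ⬝ᵥ (S *ᵥ symMatrix u 0 i) := by
  have h : ∀ i, symMatrix u 0 i ⬝ᵥ (S *ᵥ symMatrix u 0 i) =
      ∑ j, symMatrix u 0 i j * (symMatrix u 0 * S) i j := by
    intro i
    rw [dotProduct]
    refine Finset.sum_congr rfl fun j _ => ?_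
    rw [Matrix.mul_apply, Matrix.mulVec, dotProduct]
    congr 1
    refine Finset.sum_congr rfl fun k _ => ?_
    rw [mul_comm, congrFun (congrFun hS k) j |>.symm, Matrix.transpose_apply]
  simp only [h]
  rw [sum_symMatrix_mul]
  exact Finset.sum_congr rfl fun e _ => by rw [popHessian_mulVec S hS]; rfl

theorem sum_norm_sq_symMatrix (u : Edge p → ℝ) :
    ∑ i, ‖WithLp.toLp 2 (symMatrix u 0 i)‖ ^ 2 = 2 * ‖WithLp.toLp 2 u‖ ^ 2 := by
  simp only [norm_toLp_sq]
  have := sum_symMatrix_mul u (symMatrix u 0)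
  simp only [sq]
  rw [this, Finset.mul_sum]
  refine Finset.sum_congr rfl fun e _ => ?_
  rw [symMatrix_symm u 0 e.1.2, symMatrix_edge]
  ring

/-- The constant 2 is not sharp, but suffices. -/
theorem norm_symMatrix_row_le (u : Edge p → ℝ) (i : Fin p) :
    ‖WithLp.toLp 2 (symMatrix u 0 i)‖ ≤ 2 * ‖WithLp.toLp 2 u‖ := by
  have h1 := Finset.single_le_sum
    (f := fun i => ‖WithLp.toLp 2 (symMatrix u 0 i)‖ ^ 2) (fun _ _ => sq_nonneg _)
    (Finset.mem_univ i)
  rw [sum_norm_sq_symMatrix] at h1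
  refine abs_le_of_sq_le_sq' ?_ (by positivity) |>.2
  nlinarith [sq_nonneg ‖WithLp.toLp 2 u‖]

theorem popHessian_sub (S T : Matrix (Fin p) (Fin p) ℝ) :
    Matrix.of (popHessian S) - Matrix.of (popHessian T) = Matrix.of (popHessian (S - T)) := by
  ext e f
  simp only [Matrix.sub_apply, Matrix.of_apply, popHessian]
  split_ifs <;> ring

theorem abs_popHessian_le (S : Matrix (Fin p) (Fin p) ℝ) (c : ℝ) (hS : ∀ i j, |S i j| ≤ c)
    (e f : Edge p) : |popHessian S e f| ≤ 4 * c := by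
  have hc : 0 ≤ c := (abs_nonneg _).trans (hS e.1.1 e.1.1)
  have key : ∀ (P : Prop) [Decidable P] (i j : Fin p), |if P then S i j else 0| ≤ c := by
    intro P _ i j
    split_ifs
    · exact hS i j
    · simpa using hc
  rw [popHessian]
  have h1 := abs_le.mp (key (e.1.1 = f.1.1) e.1.2 f.1.2)
  have h2 := abs_le.mp (key (e.1.2 = f.1.2) e.1.1 f.1.1)
  have h3 := abs_le.mp (key (e.1.2 = f.1.1) e.1.1 f.1.2)
  have h4 := abs_le.mp (key (e.1.1 = f.1.2) e.1.2 f.1.1)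
  rw [abs_le]
  constructor <;> linarith

/-- The sample second moment matrix. -/
noncomputable def sampleCov {n : ℕ} (y : Fin n → Fin p → ℝ) : Matrix (Fin p) (Fin p) ℝ :=
  fun i j => (n : ℝ)⁻¹ * ∑ k, y k i * y k j

theorem sampleCov_transpose {n : ℕ} (y : Fin n → Fin p → ℝ) :
    (sampleCov y)ᵀ = sampleCov y := by
  ext i j
  simp only [Matrix.transpose_apply, sampleCov]
  congr 1
  exact Finset.sum_congr rfl fun _ _ => mul_comm _ _

theorem dotProduct_sampleCov_mulVec {n : ℕ} (y : Fin n → Fin p → ℝ) (a b : Fin p → ℝ) :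
    a ⬝ᵥ (sampleCov y *ᵥ b) = (n : ℝ)⁻¹ * ∑ k, (a ⬝ᵥ y k) * (b ⬝ᵥ y k) := by
  have h1 : ∀ k, (a ⬝ᵥ y k) * (b ⬝ᵥ y k) = ∑ i, ∑ j, a i * (y k i * y k j) * b j := fun k => by
    simp only [dotProduct, Finset.sum_mul_sum]
    exact Finset.sum_congr rfl fun _ _ => Finset.sum_congr rfl fun _ _ => by ring
  simp only [h1]
  rw [Finset.sum_comm]
  simp only [dotProduct, Matrix.mulVec, sampleCov, Finset.mul_sum]
  refine Finset.sum_congr rfl fun i _ => ?_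
  rw [Finset.sum_comm]
  refine Finset.sum_congr rfl fun j _ => ?_
  rw [Finset.sum_mul, Finset.mul_sum]
  exact Finset.sum_congr rfl fun k _ => by ring

theorem dotProduct_sampleCov_self_nonneg {n : ℕ} (y : Fin n → Fin p → ℝ) (a : Fin p → ℝ) :
    0 ≤ a ⬝ᵥ (sampleCov y *ᵥ a) := by
  rw [dotProduct_sampleCov_mulVec]
  exact mul_nonneg (by positivity) (Finset.sum_nonneg fun k _ => mul_self_nonneg _)

theorem Lcon_eq {n : ℕ} (hn : n ≠ 0) (y : Fin n → Fin p → ℝ) (M : Matrix (Fin p) (Fin p) ℝ) :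
    Lcon y M = n * (-∑ i, Real.log (M i i) + 1 / 2 * ∑ i, M i ⬝ᵥ (sampleCov y *ᵥ M i)) := by
  have hn' : (n : ℝ) ≠ 0 := by exact_mod_cast hn
  have h : ∀ i, ∑ k, (∑ j, M i j * y k j) ^ 2 = n * (M i ⬝ᵥ (sampleCov y *ᵥ M i)) := fun i => by
    rw [dotProduct_sampleCov_mulVec, mul_inv_cancel_left₀ hn']
    exact Finset.sum_congr rfl fun k _ => sq _
  simp only [Lcon, h, ← Finset.mul_sum]
  ring

/-- Exact second order Taylor expansion of the smooth part of the objective. -/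
theorem Lcon_add {n : ℕ} (hn : n ≠ 0) (y : Fin n → Fin p → ℝ) (w v : Edge p → ℝ)
    (d : Fin p → ℝ) :
    Lcon y (symMatrix (w + v) d) = Lcon y (symMatrix w d) +
      n * (quadGrad (sampleCov y) (symMatrix w d) ⬝ᵥ v +
        1 / 2 * (v ⬝ᵥ (Matrix.of (popHessian (sampleCov y)) *ᵥ v))) := by
  set S := sampleCov y with hS
  have hSt : Sᵀ = S := sampleCov_transpose y
  have hcross : quadGrad S (symMatrix w d) ⬝ᵥ v =
      ∑ i, symMatrix v 0 i ⬝ᵥ (S *ᵥ symMatrix w d i) := by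
    have h : ∀ i, symMatrix v 0 i ⬝ᵥ (S *ᵥ symMatrix w d i) =
        ∑ j, symMatrix v 0 i j * (symMatrix w d * S) i j := by
      intro i
      rw [dotProduct]
      refine Finset.sum_congr rfl fun j _ => ?_
      rw [Matrix.mul_apply, Matrix.mulVec, dotProduct]
      congr 1
      refine Finset.sum_congr rfl fun k _ => ?_
      rw [mul_comm, congrFun (congrFun hSt k) j |>.symm, Matrix.transpose_apply]
    simp only [h]
    rw [sum_symMatrix_mul, dotProduct_comm]
    rfl
  have hsymm : ∀ a b : Fin p → ℝ, a ⬝ᵥ (S *ᵥ b) = b ⬝ᵥ (S *ᵥ a) := fun a b => by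
    rw [Matrix.dotProduct_mulVec, ← Matrix.mulVec_transpose, hSt, dotProduct_comm]
  rw [Lcon_eq hn, Lcon_eq hn, hcross, popHessian_quadratic S hSt, ← hS]
  have h1 : ∀ i, symMatrix (w + v) d i ⬝ᵥ (S *ᵥ symMatrix (w + v) d i) =
      symMatrix w d i ⬝ᵥ (S *ᵥ symMatrix w d i) + 2 * (symMatrix v 0 i ⬝ᵥ (S *ᵥ symMatrix w d i))
        + symMatrix v 0 i ⬝ᵥ (S *ᵥ symMatrix v 0 i) := by
    intro i
    have : symMatrix (w + v) d i = symMatrix w d i + symMatrix v 0 i := by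
      rw [symMatrix_add]; rfl
    rw [this, Matrix.mulVec_add, dotProduct_add, add_dotProduct, add_dotProduct,
      hsymm (symMatrix w d i) (symMatrix v 0 i)]
    ring
  simp only [h1, Finset.sum_add_distrib, symMatrix_diag, ← Finset.mul_sum]
  ring

/-- Curvature is needed along A only; elsewhere positive semidefiniteness of the sample covariance
and strict dual feasibility suffice. -/
theorem Qcon_lt_of_kkt {n : ℕ} (hn : n ≠ 0) (y : Fin n → Fin p → ℝ) (d : Fin p → ℝ)
    (w : Edge p → ℝ) (l : ℝ) (A : Finset (Edge p)) (hl : 0 < l)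
    (hpos : ∀ v : Edge p → ℝ, (∀ e ∉ A, v e = 0) → v ≠ 0 →
      0 < v ⬝ᵥ (Matrix.of (popHessian (sampleCov y)) *ᵥ v))
    (hA : ∀ e ∈ A, quadGrad (sampleCov y) (symMatrix w d) e = -l * Real.sign (w e) ∧ w e ≠ 0)
    (hAc : ∀ e ∉ A, w e = 0 ∧ |quadGrad (sampleCov y) (symMatrix w d) e| < l)
    (v : Edge p → ℝ) (hv : v ≠ w) :
    Qcon y (n * l) (symMatrix w d) < Qcon y (n * l) (symMatrix v d) := by
  have hn' : (0 : ℝ) < n := by exact_mod_cast Nat.pos_of_ne_zero hn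
  have h := penalized_lt_of_kkt (Matrix.of (popHessian (sampleCov y)))
    (fun w => (n : ℝ)⁻¹ * Lcon y (symMatrix w d)) w _ l A hl (fun u => by
      rw [Lcon_add hn]
      field_simp
      ring) (fun u => by
      rw [popHessian_quadratic _ (sampleCov_transpose y)]
      exact Finset.sum_nonneg fun i _ => dotProduct_sampleCov_self_nonneg y _)
    hpos hA hAc (v - w) (sub_ne_zero.mpr hv)
  rw [add_sub_cancel] at h
  have h2 := mul_lt_mul_of_pos_left h hn'
  simp only [Qcon, offDiag_symMatrix]
  rw [mul_add, mul_add, mul_inv_cancel_left₀ hn'.ne', mul_inv_cancel_left₀ hn'.ne'] at h2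
  linarith

theorem quadGrad_add (S : Matrix (Fin p) (Fin p) ℝ) (hS : Sᵀ = S) (w u : Edge p → ℝ)
    (d : Fin p → ℝ) :
    quadGrad S (symMatrix (w + u) d) =
      quadGrad S (symMatrix w d) + Matrix.of (popHessian S) *ᵥ u := by
  ext e
  rw [Pi.add_apply, popHessian_mulVec S hS, symMatrix_add]
  simp only [quadGrad, Matrix.add_mul, Matrix.add_apply]
  ring

end Algebra

/-! ### From eigenvalue bounds to bounds on quadratic forms and inverses. -/

section Spectrum

variable {ι : Type*} [Fintype ι]

theorem dotProduct_mulVec_comm {S : Matrix ι ι ℝ} (hS : Sᵀ = S) (a b : ι → ℝ) :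
    a ⬝ᵥ (S *ᵥ b) = b ⬝ᵥ (S *ᵥ a) := by
  rw [Matrix.dotProduct_mulVec, ← Matrix.mulVec_transpose, hS, dotProduct_comm]

/-- M - a and b - M are Hermitian with nonnegative spectrum, hence positive semidefinite. -/
theorem spectrum_bounds [DecidableEq ι] {M : Matrix ι ι ℝ} (hM : M.IsHermitian) {a b : ℝ}
    (h : ∀ t ∈ spectrum ℝ M, a ≤ t ∧ t ≤ b) (x : ι → ℝ) :
    a * ‖WithLp.toLp 2 x‖ ^ 2 ≤ x ⬝ᵥ (M *ᵥ x) ∧ x ⬝ᵥ (M *ᵥ x) ≤ b * ‖WithLp.toLp 2 x‖ ^ 2 := by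
  have hsc : ∀ c : ℝ, (algebraMap ℝ (Matrix ι ι ℝ) c).IsHermitian := fun c => by
    rw [Matrix.algebraMap_eq_diagonal]
    exact Matrix.isHermitian_diagonal _
  have hx : ∀ c : ℝ, x ⬝ᵥ (algebraMap ℝ (Matrix ι ι ℝ) c *ᵥ x) = c * ‖WithLp.toLp 2 x‖ ^ 2 := by
    intro c
    rw [← dotProduct_self_eq_norm_sq, Algebra.algebraMap_eq_smul_one, Matrix.smul_mulVec,
      Matrix.one_mulVec, dotProduct_smul, smul_eq_mul]
  constructor
  · have h1 : (M - algebraMap ℝ _ a).PosSemidef := by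
      rw [Matrix.posSemidef_iff_isHermitian_and_spectrum_nonneg]
      refine ⟨hM.sub (hsc a), fun t ht => ?_⟩
      rw [← spectrum.sub_singleton_eq] at ht
      obtain ⟨s, hs, r, rfl, rfl⟩ := ht
      exact sub_nonneg.mpr (h s hs).1
    have h2 := h1.dotProduct_mulVec_nonneg x
    rw [Matrix.sub_mulVec, dotProduct_sub, star_trivial, hx] at h2
    linarith
  · have h1 : (algebraMap ℝ _ b - M).PosSemidef := by
      rw [Matrix.posSemidef_iff_isHermitian_and_spectrum_nonneg]
      refine ⟨(hsc b).sub hM, fun t ht => ?_⟩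
      rw [← spectrum.singleton_sub_eq] at ht
      obtain ⟨r, rfl, s, hs, rfl⟩ := ht
      exact sub_nonneg.mpr (h s hs).2
    have h2 := h1.dotProduct_mulVec_nonneg x
    rw [Matrix.sub_mulVec, dotProduct_sub, star_trivial, hx] at h2
    linarith

variable {M : Matrix ι ι ℝ} {a b : ℝ}

theorem sq_norm_mulVec_le (hM : Mᵀ = M) (hb : 0 ≤ b) (hpsd : ∀ x, 0 ≤ x ⬝ᵥ (M *ᵥ x))
    (h : ∀ x, x ⬝ᵥ (M *ᵥ x) ≤ b * ‖WithLp.toLp 2 x‖ ^ 2) (x : ι → ℝ) :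
    ‖WithLp.toLp 2 (M *ᵥ x)‖ ^ 2 ≤ b * (x ⬝ᵥ (M *ᵥ x)) := by
  -- For b = 0 the form vanishes identically, and polarization at x + M x gives M x = 0.
  rcases hb.eq_or_lt with rfl | hb
  · have h0 : ∀ z, z ⬝ᵥ (M *ᵥ z) = 0 := fun z => le_antisymm (by simpa using h z) (hpsd z)
    have h1 := h0 (x + M *ᵥ x)
    rw [Matrix.mulVec_add, dotProduct_add, add_dotProduct, add_dotProduct, h0, h0,
      dotProduct_mulVec_comm hM x (M *ᵥ x), dotProduct_self_eq_norm_sq] at h1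
    rw [h0]
    linarith
  -- Nonnegativity at this vector, with the upper bound at M x, gives M² ≤ b M without a matrix
  -- square root.
  have h1 := hpsd (x - b⁻¹ • (M *ᵥ x))
  have h2 := h (M *ᵥ x)
  rw [Matrix.mulVec_sub, Matrix.mulVec_smul, dotProduct_sub, sub_dotProduct, sub_dotProduct,
    smul_dotProduct, smul_dotProduct, dotProduct_smul, dotProduct_smul,
    dotProduct_mulVec_comm hM x (M *ᵥ x), dotProduct_self_eq_norm_sq] at h1
  simp only [smul_eq_mul] at h1
  set N := ‖WithLp.toLp 2 (M *ᵥ x)‖ ^ 2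
  have h3 : b⁻¹ * (b⁻¹ * (M *ᵥ x ⬝ᵥ M *ᵥ (M *ᵥ x))) ≤ b⁻¹ * (b⁻¹ * (b * N)) := by gcongr
  rw [inv_mul_cancel_left₀ hb.ne'] at h3
  have h4 : b⁻¹ * N ≤ x ⬝ᵥ (M *ᵥ x) := by linarith
  rwa [inv_mul_le_iff₀ hb] at h4

theorem norm_mulVec_le_of_le (hM : Mᵀ = M) (hb : 0 ≤ b) (hpsd : ∀ x, 0 ≤ x ⬝ᵥ (M *ᵥ x))
    (h : ∀ x, x ⬝ᵥ (M *ᵥ x) ≤ b * ‖WithLp.toLp 2 x‖ ^ 2) (x : ι → ℝ) :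
    ‖WithLp.toLp 2 (M *ᵥ x)‖ ≤ b * ‖WithLp.toLp 2 x‖ := by
  refine abs_le_of_sq_le_sq' ?_ (by positivity) |>.2
  calc _ ≤ b * (x ⬝ᵥ (M *ᵥ x)) := sq_norm_mulVec_le hM hb hpsd h x
    _ ≤ b * (b * ‖WithLp.toLp 2 x‖ ^ 2) := by gcongr; exact h x
    _ = _ := by ring

/-- Two-sided bounds for a positive definite matrix give two-sided bounds for its inverse. -/
theorem inv_bounds [DecidableEq ι] (hM : Mᵀ = M) (hdet : IsUnit M.det) (ha : 0 < a) (hb : 0 < b)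
    (hlow : ∀ x, a * ‖WithLp.toLp 2 x‖ ^ 2 ≤ x ⬝ᵥ (M *ᵥ x))
    (hup : ∀ x, x ⬝ᵥ (M *ᵥ x) ≤ b * ‖WithLp.toLp 2 x‖ ^ 2) (x : ι → ℝ) :
    b⁻¹ * ‖WithLp.toLp 2 x‖ ^ 2 ≤ x ⬝ᵥ (M⁻¹ *ᵥ x) ∧
    x ⬝ᵥ (M⁻¹ *ᵥ x) ≤ a⁻¹ * ‖WithLp.toLp 2 x‖ ^ 2 := by
  -- In terms of z the claims read ‖M z‖² ≤ b z'Mz and a z'Mz ≤ ‖M z‖².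
  obtain ⟨z, rfl⟩ : ∃ z, x = M *ᵥ z :=
    ⟨M⁻¹ *ᵥ x, by rw [Matrix.mulVec_mulVec, Matrix.mul_nonsing_inv _ hdet, Matrix.one_mulVec]⟩
  rw [Matrix.mulVec_mulVec, Matrix.nonsing_inv_mul _ hdet, Matrix.one_mulVec, dotProduct_comm]
  constructor
  · rw [inv_mul_le_iff₀ hb]
    exact sq_norm_mulVec_le hM hb.le (fun x => le_trans (by positivity) (hlow x)) hup z
  · have h1 := hlow z
    have h2 := (le_abs_self _).trans (abs_dotProduct_le_norm z (M *ᵥ z))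
    rw [← div_eq_inv_mul, le_div_iff₀ ha]
    set N := ‖WithLp.toLp 2 (M *ᵥ z)‖
    set Z := ‖WithLp.toLp 2 z‖
    have hN : 0 ≤ N := norm_nonneg _
    have hZ : 0 ≤ Z := norm_nonneg _
    have h3 : a * Z ≤ N := by
      rcases hZ.eq_or_lt with h0 | h0
      · rw [← h0]; simpa using hN
      · nlinarith
    nlinarith

end Spectrum

/-! ### Exponential moments and the Chernoff bound. -/

section Moments

variable {X : Type*} [MeasurableSpace X] {μ : Measure X}

theorem exp_le_one_add_self_add_sq_mul_exp_abs (y : ℝ) :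
    Real.exp y ≤ 1 + y + y ^ 2 * Real.exp |y| := by
  have h := Complex.norm_exp_sub_sum_le_norm_mul_exp (y : ℂ) 2
  rw [Finset.sum_range_succ, Finset.sum_range_one] at h
  simp only [pow_zero, pow_one, Nat.factorial, Nat.cast_one, div_one, Complex.norm_real,
    Real.norm_eq_abs, sq_abs, mul_one] at h
  rw [← Complex.ofReal_exp, ← Complex.ofReal_one, ← Complex.ofReal_add, ← Complex.ofReal_sub,
    Complex.norm_real, Real.norm_eq_abs] at h
  linarith [(abs_le.mp h).2]

/-- A random variable with a finite exponential moment has a sub-gamma moment generating function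
near the origin. -/
theorem integral_exp_mul_le [IsProbabilityMeasure μ] {Z : X → ℝ} (hZ : AEMeasurable Z μ)
    {β K s : ℝ} (hβ : 0 < β) (hint : Integrable (fun ξ => Real.exp (β * |Z ξ|)) μ)
    (hK : ∫ ξ, Real.exp (β * |Z ξ|) ∂μ ≤ K) (hs : |s| ≤ β / 2) :
    Integrable (fun ξ => Real.exp (s * Z ξ)) μ ∧
      ∫ ξ, Real.exp (s * Z ξ) ∂μ ≤ Real.exp (s * ∫ ξ, Z ξ ∂μ + 8 * K / β ^ 2 * s ^ 2) := by
  have hZint : Integrable Z μ := by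
    refine (hint.const_mul β⁻¹).mono' hZ.aestronglyMeasurable (Eventually.of_forall fun ξ => ?_)
    rw [Real.norm_eq_abs, ← div_eq_inv_mul, le_div_iff₀ hβ]
    linarith [Real.add_one_le_exp (β * |Z ξ|)]
  have hsZ : ∀ ξ, |s * Z ξ| ≤ β / 2 * |Z ξ| := fun ξ => by
    rw [abs_mul]; exact mul_le_mul_of_nonneg_right hs (abs_nonneg _)
  have h1 : Integrable (fun ξ => Real.exp (s * Z ξ)) μ := by
    refine hint.mono' (hZ.const_mul s).exp.aestronglyMeasurable (Eventually.of_forall fun ξ => ?_)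
    rw [Real.norm_eq_abs, Real.abs_exp, Real.exp_le_exp]
    have := (le_abs_self _).trans (hsZ ξ)
    nlinarith [abs_nonneg (Z ξ)]
  refine ⟨h1, ?_⟩
  have hlin : Integrable (fun ξ => 1 + s * Z ξ) μ := (integrable_const 1).add (hZint.const_mul s)
  -- Half of the exponent β|Z| absorbs e^|sZ|, the other half absorbs (sZ)² through y²/2 ≤ e^y; this
  -- produces the 8.
  have hpt : ∀ ξ, Real.exp (s * Z ξ) ≤
      1 + s * Z ξ + 8 / β ^ 2 * s ^ 2 * Real.exp (β * |Z ξ|) := by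
    intro ξ
    refine (exp_le_one_add_self_add_sq_mul_exp_abs _).trans ?_
    have h2 : Real.exp |s * Z ξ| ≤ Real.exp (β / 2 * |Z ξ|) := Real.exp_le_exp.mpr (hsZ ξ)
    have h3 : (β / 2 * |Z ξ|) ^ 2 / 2 ≤ Real.exp (β / 2 * |Z ξ|) := by
      have := Real.quadratic_le_exp_of_nonneg (x := β / 2 * |Z ξ|) (by positivity)
      nlinarith [abs_nonneg (Z ξ)]
    have h4 : Real.exp (β * |Z ξ|) = Real.exp (β / 2 * |Z ξ|) * Real.exp (β / 2 * |Z ξ|) := by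
      rw [← Real.exp_add]; ring_nf
    have h5 : (s * Z ξ) ^ 2 * Real.exp |s * Z ξ| ≤
        (8 / β ^ 2 * s ^ 2 * Real.exp (β / 2 * |Z ξ|)) * Real.exp (β / 2 * |Z ξ|) := by
      refine mul_le_mul ?_ h2 (Real.exp_pos _).le (by positivity)
      calc (s * Z ξ) ^ 2 = 8 / β ^ 2 * s ^ 2 * ((β / 2 * |Z ξ|) ^ 2 / 2) := by
            rw [mul_pow (β / 2), sq_abs]; field_simp; ring
        _ ≤ _ := by gcongr
    rw [h4]
    linarith
  calc ∫ ξ, Real.exp (s * Z ξ) ∂μ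
      ≤ ∫ ξ, (1 + s * Z ξ + 8 / β ^ 2 * s ^ 2 * Real.exp (β * |Z ξ|)) ∂μ :=
        integral_mono h1 (hlin.add (hint.const_mul _)) hpt
    _ = 1 + s * ∫ ξ, Z ξ ∂μ + 8 / β ^ 2 * s ^ 2 * ∫ ξ, Real.exp (β * |Z ξ|) ∂μ := by
        rw [integral_add hlin (hint.const_mul _),
          integral_add (integrable_const 1) (hZint.const_mul s), integral_const_mul,
          integral_const_mul]
        simp
    _ ≤ 1 + s * ∫ ξ, Z ξ ∂μ + 8 / β ^ 2 * s ^ 2 * K := by gcongr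
    _ = (s * ∫ ξ, Z ξ ∂μ + 8 * K / β ^ 2 * s ^ 2) + 1 := by ring
    _ ≤ _ := Real.add_one_le_exp _

/-- Completing the square writes exp(z²/(4b)) as a Gaussian mixture of exp(tz), which turns bounds
on the moment generating function of Z into bounds for Z². -/
theorem lintegral_exp_mul_sub_sq {b : ℝ} (hb : 0 < b) (z : ℝ) :
    ∫⁻ t : ℝ, ENNReal.ofReal (Real.exp (t * z - b * t ^ 2)) =
      ENNReal.ofReal (√(Real.pi / b) * Real.exp (z ^ 2 / (4 * b))) := by
  have h1 : ∀ t : ℝ, Real.exp (t * z - b * t ^ 2) =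
      Real.exp (-b * (t - z / (2 * b)) ^ 2) * Real.exp (z ^ 2 / (4 * b)) := fun t => by
    rw [← Real.exp_add]
    congr 1
    field_simp
    ring
  have hint := ((integrable_exp_neg_mul_sq hb).comp_sub_right (z / (2 * b))).mul_const
    (Real.exp (z ^ 2 / (4 * b)))
  simp only [h1]
  rw [← ofReal_integral_eq_lintegral_ofReal hint (Eventually.of_forall fun t => by positivity),
    integral_mul_const,
    integral_sub_right_eq_self (fun t => Real.exp (-b * t ^ 2)) (z / (2 * b)), integral_gaussian]

/-- The square of a sub-Gaussian random variable has a finite exponential moment. -/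
theorem integral_exp_sq_le [SFinite μ] {Z : X → ℝ} (hZ : Measurable Z) {v : ℝ} (hv : 0 < v)
    (hsub : ∀ t : ℝ, Integrable (fun ξ => Real.exp (t * Z ξ)) μ ∧
      ∫ ξ, Real.exp (t * Z ξ) ∂μ ≤ Real.exp (v * t ^ 2)) :
    Integrable (fun ξ => Real.exp (1 / (8 * v) * Z ξ ^ 2)) μ ∧
      ∫ ξ, Real.exp (1 / (8 * v) * Z ξ ^ 2) ∂μ ≤ √2 := by
  have hmeas : Measurable fun ξ => Real.exp (1 / (8 * v) * Z ξ ^ 2) := by fun_prop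
  have hc : 0 < √(Real.pi / (2 * v)) := by positivity
  -- Mixture with b = 2v: after Tonelli, e^(vt²) cancels half of e^(-2vt²), leaving a Gaussian
  -- integral. The ratio of the two normalizations is √2.
  have key : ∫⁻ ξ, ENNReal.ofReal (√(Real.pi / (2 * v)) * Real.exp (1 / (8 * v) * Z ξ ^ 2)) ∂μ ≤
      ENNReal.ofReal (√(Real.pi / v)) := by
    have h1 : ∀ ξ, ENNReal.ofReal (√(Real.pi / (2 * v)) * Real.exp (1 / (8 * v) * Z ξ ^ 2)) =
        ∫⁻ t : ℝ, ENNReal.ofReal (Real.exp (t * Z ξ - 2 * v * t ^ 2)) := fun ξ => by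
      rw [lintegral_exp_mul_sub_sq (by positivity)]
      congr 3
      field_simp
      ring
    simp only [h1]
    rw [lintegral_lintegral_swap (by fun_prop)]
    have h2 := lintegral_exp_mul_sub_sq hv 0
    simp only [mul_zero, zero_sub, ne_eq, OfNat.ofNat_ne_zero, not_false_eq_true, zero_pow,
      zero_div, Real.exp_zero, mul_one] at h2
    rw [← h2]
    refine lintegral_mono fun t => ?_
    have h3 : ∀ ξ, Real.exp (t * Z ξ - 2 * v * t ^ 2) =
        Real.exp (t * Z ξ) * Real.exp (-(2 * v * t ^ 2)) := fun ξ => by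
      rw [← Real.exp_add]; ring_nf
    simp only [h3]
    rw [← ofReal_integral_eq_lintegral_ofReal ((hsub t).1.mul_const _)
      (Eventually.of_forall fun ξ => by positivity), integral_mul_const]
    refine ENNReal.ofReal_le_ofReal ?_
    calc (∫ ξ, Real.exp (t * Z ξ) ∂μ) * Real.exp (-(2 * v * t ^ 2))
        ≤ Real.exp (v * t ^ 2) * Real.exp (-(2 * v * t ^ 2)) := by gcongr; exact (hsub t).2
      _ = Real.exp (-(v * t ^ 2)) := by rw [← Real.exp_add]; ring_nf
  have hint : Integrable
      (fun ξ => √(Real.pi / (2 * v)) * Real.exp (1 / (8 * v) * Z ξ ^ 2)) μ := by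
    refine (lintegral_ofReal_ne_top_iff_integrable (by fun_prop)
      (Eventually.of_forall fun ξ => by positivity)).mp ?_
    exact (key.trans_lt ENNReal.ofReal_lt_top).ne
  have hint' : Integrable (fun ξ => Real.exp (1 / (8 * v) * Z ξ ^ 2)) μ := by
    simpa [hc.ne'] using hint.const_mul (√(Real.pi / (2 * v)))⁻¹
  refine ⟨hint', ?_⟩
  rw [← ofReal_integral_eq_lintegral_ofReal hint (Eventually.of_forall fun ξ => by positivity),
    ENNReal.ofReal_le_ofReal_iff (by positivity), integral_const_mul] at key
  have h4 : √(Real.pi / v) = √(Real.pi / (2 * v)) * √2 := by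
    rw [← Real.sqrt_mul (by positivity)]
    congr 1
    field_simp
  rw [h4] at key
  exact le_of_mul_le_mul_left key hc

/-- Moment generating function of the product of two sub-Gaussian variables. -/
theorem integral_exp_mul_mul_le [IsProbabilityMeasure μ] {Z₁ Z₂ : X → ℝ} (hZ₁ : Measurable Z₁)
    (hZ₂ : Measurable Z₂) {v : ℝ} (hv : 0 < v)
    (h₁ : ∀ t : ℝ, Integrable (fun ξ => Real.exp (t * Z₁ ξ)) μ ∧
      ∫ ξ, Real.exp (t * Z₁ ξ) ∂μ ≤ Real.exp (v * t ^ 2))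
    (h₂ : ∀ t : ℝ, Integrable (fun ξ => Real.exp (t * Z₂ ξ)) μ ∧
      ∫ ξ, Real.exp (t * Z₂ ξ) ∂μ ≤ Real.exp (v * t ^ 2))
    {s : ℝ} (hs : |s| ≤ 1 / (16 * v)) :
    Integrable (fun ξ => Real.exp (s * (Z₁ ξ * Z₂ ξ))) μ ∧
      ∫ ξ, Real.exp (s * (Z₁ ξ * Z₂ ξ)) ∂μ ≤
        Real.exp (s * ∫ ξ, Z₁ ξ * Z₂ ξ ∂μ + 1024 * v ^ 2 * s ^ 2) := by
  obtain ⟨i₁, e₁⟩ := integral_exp_sq_le hZ₁ hv h₁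
  obtain ⟨i₂, e₂⟩ := integral_exp_sq_le hZ₂ hv h₂
  have hsq : √(2 : ℝ) ≤ 2 := by
    rw [Real.sqrt_le_left (by norm_num)]; norm_num
  have hβ : 0 < 1 / (8 * v) := by positivity
  have hpt : ∀ ξ, Real.exp (1 / (8 * v) * |Z₁ ξ * Z₂ ξ|) ≤
      1 / 2 * Real.exp (1 / (8 * v) * Z₁ ξ ^ 2) + 1 / 2 * Real.exp (1 / (8 * v) * Z₂ ξ ^ 2) := by
    intro ξ
    have h1 : |Z₁ ξ * Z₂ ξ| ≤ 1 / 2 * Z₁ ξ ^ 2 + 1 / 2 * Z₂ ξ ^ 2 := by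
      rw [abs_mul, ← sq_abs (Z₁ ξ), ← sq_abs (Z₂ ξ)]
      nlinarith [sq_nonneg (|Z₁ ξ| - |Z₂ ξ|)]
    refine (Real.exp_le_exp.mpr (mul_le_mul_of_nonneg_left h1 hβ.le)).trans ?_
    have := convexOn_exp.2 (Set.mem_univ (1 / (8 * v) * Z₁ ξ ^ 2))
      (Set.mem_univ (1 / (8 * v) * Z₂ ξ ^ 2)) (by norm_num : (0 : ℝ) ≤ 1 / 2)
      (by norm_num : (0 : ℝ) ≤ 1 / 2) (by norm_num)
    simp only [smul_eq_mul] at this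
    refine le_trans (le_of_eq ?_) this
    ring_nf
  have hsum := (i₁.const_mul (1 / 2)).add (i₂.const_mul (1 / 2))
  have hint : Integrable (fun ξ => Real.exp (1 / (8 * v) * |Z₁ ξ * Z₂ ξ|)) μ := by
    refine hsum.mono' ?_ (Eventually.of_forall fun ξ => ?_)
    · exact (((hZ₁.mul hZ₂).abs).const_mul _).exp.aestronglyMeasurable
    · rw [Real.norm_eq_abs, Real.abs_exp]; exact hpt ξ
  have hK : ∫ ξ, Real.exp (1 / (8 * v) * |Z₁ ξ * Z₂ ξ|) ∂μ ≤ 2 := by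
    refine (integral_mono hint hsum hpt).trans ?_
    simp only [Pi.add_apply]
    rw [integral_add (i₁.const_mul _) (i₂.const_mul _), integral_const_mul, integral_const_mul]
    linarith
  -- With β = 1/(8v) and K = 2, the constant 8K/β² equals 1024v².
  have := integral_exp_mul_le (hZ₁.mul hZ₂).aemeasurable hβ hint hK (s := s)
    (hs.trans (le_of_eq (by field_simp; norm_num)))
  refine ⟨this.1, this.2.trans (le_of_eq ?_)⟩
  congr 2
  field_simp
  ring

/-- Chernoff bound for a sum of independent variables with sub-gamma moment generating
functions. -/
theorem measureReal_le_abs_sum_sub_le [IsProbabilityMeasure μ] {n : ℕ} {Z : Fin n → X → ℝ}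
    (hZ : ∀ k, Measurable (Z k)) (hind : iIndepFun Z μ) {m C s : ℝ} (hs : 0 ≤ s)
    (hmgf : ∀ k, ∀ t, |t| ≤ s → Integrable (fun ξ => Real.exp (t * Z k ξ)) μ ∧
      ∫ ξ, Real.exp (t * Z k ξ) ∂μ ≤ Real.exp (t * m + C * t ^ 2)) (r : ℝ) :
    μ.real {ξ | n * r ≤ |∑ k, Z k ξ - n * m|} ≤ 2 * Real.exp (n * (C * s ^ 2 - s * r)) := by
  have hint : ∀ t, |t| ≤ s → Integrable (fun ξ => Real.exp (t * (∑ k, Z k) ξ)) μ := fun t ht =>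
    hind.integrable_exp_mul_sum hZ fun k _ => (hmgf k t ht).1
  have hsum : ∀ t, |t| ≤ s → mgf (∑ k, Z k) μ t ≤ Real.exp (n * (t * m + C * t ^ 2)) := by
    intro t ht
    rw [hind.mgf_sum hZ]
    calc ∏ k, mgf (Z k) μ t ≤ ∏ _k : Fin n, Real.exp (t * m + C * t ^ 2) :=
          Finset.prod_le_prod (fun _ _ => mgf_nonneg) fun k _ => (hmgf k t ht).2
      _ = _ := by
          rw [Finset.prod_const, Finset.card_univ, Fintype.card_fin, ← Real.exp_nat_mul]
  have hs1 : |s| ≤ s := (abs_of_nonneg hs).le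
  have hs2 : |-s| ≤ s := by rw [abs_neg]; exact hs1
  have hup := measure_ge_le_exp_mul_mgf (n * m + n * r) hs (hint s hs1)
  have hlo := measure_le_le_exp_mul_mgf (n * m - n * r) (neg_nonpos.mpr hs) (hint _ hs2)
  have hup' : μ.real {ξ | n * m + n * r ≤ (∑ k, Z k) ξ} ≤ Real.exp (n * (C * s ^ 2 - s * r)) := by
    refine hup.trans ((mul_le_mul_of_nonneg_left (hsum s hs1) (Real.exp_pos _).le).trans ?_)
    rw [← Real.exp_add]
    refine le_of_eq ?_
    congr 1
    ring
  have hlo' : μ.real {ξ | (∑ k, Z k) ξ ≤ n * m - n * r} ≤ Real.exp (n * (C * s ^ 2 - s * r)) := by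
    refine hlo.trans ((mul_le_mul_of_nonneg_left (hsum _ hs2) (Real.exp_pos _).le).trans ?_)
    rw [← Real.exp_add]
    refine le_of_eq ?_
    congr 1
    ring
  have hsub : {ξ | n * r ≤ |∑ k, Z k ξ - n * m|} ⊆
      {ξ | n * m + n * r ≤ (∑ k, Z k) ξ} ∪ {ξ | (∑ k, Z k) ξ ≤ n * m - n * r} := by
    intro ξ hξ
    simp only [Set.mem_ofPred_eq, Set.mem_union, Finset.sum_apply] at hξ ⊢
    rcases le_abs.mp hξ with h | h
    · left; linarith
    · right; linarith
  calc _ ≤ _ := measureReal_mono hsub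
    _ ≤ _ := measureReal_union_le _ _
    _ ≤ _ := by linarith

end Moments

/-! ### Concentration of the sample covariance. -/

section SampleCovariance

variable {X : Type*} [MeasurableSpace X] {μ : Measure X}
  {n p : ℕ} {Y : Fin n → X → Fin p → ℝ} {S : Matrix (Fin p) (Fin p) ℝ}

theorem integral_dotProduct_mul_dotProduct {V : X → Fin p → ℝ}
    (hV : ∀ i, MemLp (fun ξ => V ξ i) 2 μ) (hcov : ∀ i j, ∫ ξ, V ξ i * V ξ j ∂μ = S i j)
    (a b : Fin p → ℝ) : ∫ ξ, (a ⬝ᵥ V ξ) * (b ⬝ᵥ V ξ) ∂μ = a ⬝ᵥ (S *ᵥ b) := by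
  have hint : ∀ i j, Integrable (fun ξ => V ξ i * V ξ j) μ := fun i j =>
    (hV i).integrable_mul (hV j)
  have h1 : ∀ ξ, (a ⬝ᵥ V ξ) * (b ⬝ᵥ V ξ) = ∑ i, ∑ j, (a i * b j) * (V ξ i * V ξ j) := fun ξ => by
    simp only [dotProduct, Finset.sum_mul_sum]
    exact Finset.sum_congr rfl fun _ _ => Finset.sum_congr rfl fun _ _ => by ring
  simp only [h1]
  rw [integral_finsetSum _ fun i _ => integrable_finsetSum _ fun j _ => (hint i j).const_mul _]
  simp only [dotProduct, Matrix.mulVec, Finset.mul_sum]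
  refine Finset.sum_congr rfl fun i _ => ?_
  rw [integral_finsetSum _ fun j _ => (hint i j).const_mul _]
  refine Finset.sum_congr rfl fun j _ => ?_
  rw [integral_const_mul, hcov]
  ring

/-- For unit a and b the deviation is a centred mean of independent products of sub-Gaussian linear
forms. The Chernoff parameter s stays free. -/
theorem measureReal_sampleCov_dev_le [IsProbabilityMeasure μ] (hn : n ≠ 0) (hY : ∀ k, Measurable (Y k))
    (hind : iIndepFun Y μ) (hL2 : ∀ k i, MemLp (fun ξ => Y k ξ i) 2 μ)
    (hcov : ∀ k i j, ∫ ξ, Y k ξ i * Y k ξ j ∂μ = S i j) {v : ℝ} (hv : 0 < v)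
    (hsub : ∀ k (x : Fin p → ℝ), Integrable (fun ξ => Real.exp (x ⬝ᵥ Y k ξ)) μ ∧
      ∫ ξ, Real.exp (x ⬝ᵥ Y k ξ) ∂μ ≤ Real.exp (v * ‖WithLp.toLp 2 x‖ ^ 2))
    {s : ℝ} (hs : 0 ≤ s) (hs' : s ≤ 1 / (16 * v)) (r : ℝ) (a b : Fin p → ℝ) :
    μ.real {ξ | ¬ |a ⬝ᵥ ((sampleCov (fun k => Y k ξ) - S) *ᵥ b)| ≤
        r * (‖WithLp.toLp 2 a‖ * ‖WithLp.toLp 2 b‖)} ≤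
      2 * Real.exp (n * (1024 * v ^ 2 * s ^ 2 - s * r)) := by
  have hn' : (0 : ℝ) < n := by exact_mod_cast Nat.pos_of_ne_zero hn
  by_cases ha : a = 0
  · simp [ha]; positivity
  by_cases hb : b = 0
  · simp [hb]; positivity
  have hna : 0 < ‖WithLp.toLp 2 a‖ := by rw [norm_pos_iff]; simpa using ha
  have hnb : 0 < ‖WithLp.toLp 2 b‖ := by rw [norm_pos_iff]; simpa using hb
  have hdot : ∀ (c : Fin p → ℝ) k, Measurable fun ξ => c ⬝ᵥ Y k ξ := fun c k => by
    have hYi : ∀ i, Measurable fun ξ => Y k ξ i := fun i => (measurable_pi_apply i).comp (hY k)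
    simp only [dotProduct]
    fun_prop
  have hscale : ∀ (c : Fin p → ℝ), 0 < ‖WithLp.toLp 2 c‖ → ∀ k (t : ℝ),
      Integrable (fun ξ => Real.exp (t * ((‖WithLp.toLp 2 c‖⁻¹ • c) ⬝ᵥ Y k ξ))) μ ∧
      ∫ ξ, Real.exp (t * ((‖WithLp.toLp 2 c‖⁻¹ • c) ⬝ᵥ Y k ξ)) ∂μ ≤ Real.exp (v * t ^ 2) := by
    intro c hc k t
    have h := hsub k (t • ‖WithLp.toLp 2 c‖⁻¹ • c)
    have h2 : ‖WithLp.toLp 2 (t • ‖WithLp.toLp 2 c‖⁻¹ • c)‖ ^ 2 = t ^ 2 := by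
      rw [WithLp.toLp_smul, WithLp.toLp_smul, norm_smul, norm_smul, norm_inv, norm_norm,
        inv_mul_cancel₀ hc.ne', mul_one, Real.norm_eq_abs, sq_abs]
    rw [h2] at h
    simpa only [smul_dotProduct t, smul_eq_mul] using h
  set a' := ‖WithLp.toLp 2 a‖⁻¹ • a with ha'
  set b' := ‖WithLp.toLp 2 b‖⁻¹ • b with hb'
  have hindZ : iIndepFun (fun k ξ => (a' ⬝ᵥ Y k ξ) * (b' ⬝ᵥ Y k ξ)) μ := by
    refine hind.comp (fun _ y => (a' ⬝ᵥ y) * (b' ⬝ᵥ y)) fun k => ?_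
    simp only [dotProduct]
    fun_prop
  have key := measureReal_le_abs_sum_sub_le
    (Z := fun k ξ => (a' ⬝ᵥ Y k ξ) * (b' ⬝ᵥ Y k ξ)) (fun k => (hdot a' k).mul (hdot b' k)) hindZ
    (m := a' ⬝ᵥ (S *ᵥ b')) (C := 1024 * v ^ 2) hs (fun k t ht => by
      rw [← integral_dotProduct_mul_dotProduct (hL2 k) (hcov k)]
      exact integral_exp_mul_mul_le (hdot a' k) (hdot b' k) hv (hscale a hna k) (hscale b hnb k)
        (ht.trans hs')) r
  refine (measureReal_mono fun ξ hξ => ?_).trans key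
  simp only [Set.mem_ofPred_eq, not_le] at hξ ⊢
  have h1 : a ⬝ᵥ ((sampleCov (fun k => Y k ξ) - S) *ᵥ b) =
      (‖WithLp.toLp 2 a‖ * ‖WithLp.toLp 2 b‖) *
        (a' ⬝ᵥ ((sampleCov (fun k => Y k ξ) - S) *ᵥ b')) := by
    rw [ha', hb', smul_dotProduct, Matrix.mulVec_smul, dotProduct_smul, smul_eq_mul, smul_eq_mul]
    field_simp
  rw [h1, abs_mul, abs_of_pos (by positivity), mul_comm r] at hξ
  have h2 := lt_of_mul_lt_mul_left hξ (by positivity)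
  rw [Matrix.sub_mulVec, dotProduct_sub, dotProduct_sampleCov_mulVec] at h2
  have h3 : ∑ k, (a' ⬝ᵥ Y k ξ) * (b' ⬝ᵥ Y k ξ) - n * (a' ⬝ᵥ (S *ᵥ b')) =
      n * ((n : ℝ)⁻¹ * ∑ k, (a' ⬝ᵥ Y k ξ) * (b' ⬝ᵥ Y k ξ) - a' ⬝ᵥ (S *ᵥ b')) := by
    rw [mul_sub, mul_inv_cancel_left₀ hn'.ne']
  rw [h3, abs_mul, abs_of_pos hn']
  exact (mul_le_mul_of_nonneg_left h2.le hn'.le)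

end SampleCovariance

theorem tendsto_sqrt_log_div_atTop :
    Tendsto (fun n : ℕ => √(Real.log n / n)) atTop (𝓝 0) := by
  have h : Tendsto (fun x : ℝ => Real.log x / x) atTop (𝓝 0) := by
    simpa using Real.tendsto_pow_log_div_mul_add_atTop 1 0 1 one_ne_zero
  simpa using (h.comp tendsto_natCast_atTop_atTop).sqrt

/-- Uniform deviation bound for the sample covariance over polynomially many directions. -/
theorem highProb_sampleCov_dev {W : ℕ → Type*} [∀ n, MeasurableSpace (W n)]
    {μ : ∀ n, Measure (W n)} [∀ n, IsProbabilityMeasure (μ n)] {p : ℕ → ℕ}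
    {Ω : ∀ n, Matrix (Fin (p n)) (Fin (p n)) ℝ} {Y : ∀ n, Fin n → W n → Fin (p n) → ℝ}
    (hmodel : IsModel μ p Ω Y) {v : ℝ} (hv : 0 < v)
    (hsub : ∀ n (k : Fin n) (x : Fin (p n) → ℝ),
      Integrable (fun ξ => Real.exp (x ⬝ᵥ Y n k ξ)) (μ n) ∧
      ∫ ξ, Real.exp (x ⬝ᵥ Y n k ξ) ∂(μ n) ≤ Real.exp (v * ‖WithLp.toLp 2 x‖ ^ 2))
    {J : ℕ → Type*} [∀ n, Fintype (J n)] (a b : ∀ n, J n → Fin (p n) → ℝ) {κ : ℝ}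
    (hJ : (fun n => (Fintype.card (J n) : ℝ)) =O[atTop] fun n : ℕ => (n : ℝ) ^ κ) (η : ℝ) :
    ∃ T : ℝ, 0 < T ∧ HighProb μ η fun n => {ξ | ∀ j,
      |a n j ⬝ᵥ ((sampleCov (fun k => Y n k ξ) - (Ω n)⁻¹) *ᵥ b n j)| ≤
        T * √(Real.log n / n) * (‖WithLp.toLp 2 (a n j)‖ * ‖WithLp.toLp 2 (b n j)‖)} := by
  -- Large enough for the exponent 1024v² - T + κ left after the union bound to be at most -η.
  set T := 1024 * v ^ 2 + |η| + |κ| + 1 with hT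
  refine ⟨T, by positivity, ?_⟩
  have hbound : ∀ᶠ n : ℕ in atTop, ‖(μ n).real {ξ | ∀ j,
      |a n j ⬝ᵥ ((sampleCov (fun k => Y n k ξ) - (Ω n)⁻¹) *ᵥ b n j)| ≤
        T * √(Real.log n / n) * (‖WithLp.toLp 2 (a n j)‖ * ‖WithLp.toLp 2 (b n j)‖)}ᶜ‖ ≤
      2 * ‖(Fintype.card (J n) : ℝ) * (n : ℝ) ^ (1024 * v ^ 2 - T)‖ := by
    filter_upwards [eventually_ge_atTop 1, tendsto_sqrt_log_div_atTop.eventually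
      (eventually_le_nhds (show (0 : ℝ) < 1 / (16 * v) by positivity))] with n hn hx
    have hn' : (0 : ℝ) < n := by exact_mod_cast hn
    have hlog : 0 ≤ Real.log n := Real.log_nonneg (by exact_mod_cast hn)
    rw [Real.norm_of_nonneg measureReal_nonneg, Real.norm_of_nonneg (by positivity)]
    have hcov : ∀ k i j, ∫ ξ, Y n k ξ i * Y n k ξ j ∂(μ n) = (Ω n)⁻¹ i j := by
      intro k i j
      have := hmodel.cov n k i j
      rw [covariance_eq_sub (hmodel.memLp n k i) (hmodel.memLp n k j), hmodel.mean, zero_mul,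
        sub_zero] at this
      exact this
    -- The Chernoff parameter equals the scale √(log n / n) of the deviation, so the exponent is a
    -- multiple of log n.
    have hexp : Real.exp (n * (1024 * v ^ 2 * √(Real.log n / n) ^ 2 -
        √(Real.log n / n) * (T * √(Real.log n / n)))) = (n : ℝ) ^ (1024 * v ^ 2 - T) := by
      have h2 : √(Real.log n / n) ^ 2 = Real.log n / n := Real.sq_sqrt (by positivity)
      rw [Real.rpow_def_of_pos hn']
      congr 1
      have h3 : √(Real.log n / n) * (T * √(Real.log n / n)) = T * √(Real.log n / n) ^ 2 := by ring
      rw [h3, h2]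
      field_simp
    have hset : {ξ | ∀ j, |a n j ⬝ᵥ ((sampleCov (fun k => Y n k ξ) - (Ω n)⁻¹) *ᵥ b n j)| ≤
        T * √(Real.log n / n) * (‖WithLp.toLp 2 (a n j)‖ * ‖WithLp.toLp 2 (b n j)‖)}ᶜ =
        ⋃ j, {ξ | ¬ |a n j ⬝ᵥ ((sampleCov (fun k => Y n k ξ) - (Ω n)⁻¹) *ᵥ b n j)| ≤
        T * √(Real.log n / n) * (‖WithLp.toLp 2 (a n j)‖ * ‖WithLp.toLp 2 (b n j)‖)} := by
      ext ξ
      simp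
    rw [hset]
    refine (measureReal_iUnion_fintype_le _).trans ?_
    calc _ ≤ ∑ _j : J n, 2 * (n : ℝ) ^ (1024 * v ^ 2 - T) := by
          refine Finset.sum_le_sum fun j _ => ?_
          rw [← hexp]
          exact measureReal_sampleCov_dev_le (Nat.one_le_iff_ne_zero.mp hn)
            (hmodel.measurable n) (hmodel.indep n) (hmodel.memLp n) hcov hv (hsub n)
            (Real.sqrt_nonneg _) hx _ _ _
      _ = _ := by
          rw [Finset.sum_const, Finset.card_univ, nsmul_eq_mul]
          ring
  refine (IsBigO.of_bound 2 hbound).trans ?_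
  refine (hJ.mul (isBigO_refl (fun n : ℕ => (n : ℝ) ^ (1024 * v ^ 2 - T)) atTop)).trans ?_
  refine IsBigO.of_bound 1 ?_
  filter_upwards [eventually_ge_atTop 1] with n hn
  have hn' : (1 : ℝ) ≤ n := by exact_mod_cast hn
  rw [← Real.rpow_add (by linarith), one_mul, Real.norm_of_nonneg (by positivity),
    Real.norm_of_nonneg (by positivity)]
  refine Real.rpow_le_rpow_of_exponent_le hn' ?_
  rw [hT]
  linarith [le_abs_self η, le_abs_self κ]

/-! ### Recovery on the good event. -/

section Deterministic

variable {p : ℕ}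

open Classical in
/-- The vector supported on `support M` that the population Hessian maps to the signs of the
off-diagonal entries along `support M`. -/
noncomputable def popDirection (M : Matrix (Fin p) (Fin p) ℝ) (e : Edge p) : ℝ :=
  if h : e ∈ support M then
    ((Matrix.of fun f g : {f // f ∈ support M} => popHessian M⁻¹ f.1 g.1)⁻¹ *ᵥ
      fun f => Real.sign (offDiag M f.1)) ⟨e, h⟩
  else 0

theorem popDirection_of_notMem {M : Matrix (Fin p) (Fin p) ℝ} {e : Edge p}
    (he : e ∉ support M) : popDirection M e = 0 := by
  simp [popDirection, he]

/-- Turns incoherence into a sup-norm bound on the image of the population direction off the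
support. -/
theorem popHessian_mulVec_popDirection (M : Matrix (Fin p) (Fin p) ℝ) (e : Edge p) :
    (Matrix.of (popHessian M⁻¹) *ᵥ popDirection M) e = incoherence M e := by
  simp only [Matrix.mulVec, dotProduct, Matrix.of_apply, incoherence]
  rw [← Finset.sum_subset (Finset.subset_univ (support M)) fun f _ hf => by
    rw [popDirection_of_notMem hf, mul_zero], ← Finset.sum_coe_sort (support M)]
  refine Finset.sum_congr rfl fun f _ => ?_
  simp [popDirection, Matrix.mulVec, dotProduct]

/-- Positivity makes the support block invertible, so its formal inverse is a true one. -/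
theorem incoherence_of_mem {M : Matrix (Fin p) (Fin p) ℝ}
    (hpos : ∀ v : Edge p → ℝ, v ≠ 0 → 0 < v ⬝ᵥ (Matrix.of (popHessian M⁻¹) *ᵥ v))
    {e : Edge p} (he : e ∈ support M) : incoherence M e = Real.sign (offDiag M e) := by
  classical
  set K : Matrix {f // f ∈ support M} {f // f ∈ support M} ℝ :=
    Matrix.of fun f g => popHessian M⁻¹ f.1 g.1 with hK
  have hunit : IsUnit K := by
    rw [← Matrix.mulVec_injective_iff_isUnit, ← Matrix.coe_mulVecLin,
      ← LinearMap.ker_eq_bot, LinearMap.ker_eq_bot']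
    intro v hv
    by_contra hne
    set w : Edge p → ℝ := fun e => if h : e ∈ support M then v ⟨e, h⟩ else 0 with hw
    have hwv : ∀ f : {f // f ∈ support M}, w f = v f := fun f => by simp [hw]
    have hw0 : w ≠ 0 := fun h => hne (funext fun f => by rw [← hwv f, h]; rfl)
    refine (hpos w hw0).ne' (Finset.sum_eq_zero fun f _ => ?_)
    by_cases hf : f ∈ support M
    · have h1 : (Matrix.of (popHessian M⁻¹) *ᵥ w) f = (K *ᵥ v) ⟨f, hf⟩ := by
        simp only [Matrix.mulVec, dotProduct, Matrix.of_apply, hK]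
        rw [← Finset.sum_subset (Finset.subset_univ (support M)) fun g _ hg => by
          simp [hw, hg], ← Finset.sum_coe_sort (support M)]
        simp only [hwv]
      have h2 : (K *ᵥ v) ⟨f, hf⟩ = 0 := congrFun hv ⟨f, hf⟩
      rw [h1, h2, mul_zero]
    · simp [hw, hf]
  have h : K *ᵥ (K⁻¹ *ᵥ fun f => Real.sign (offDiag M f.1)) =
      fun f => Real.sign (offDiag M f.1) := by
    rw [Matrix.mulVec_mulVec, Matrix.mul_nonsing_inv _ ((Matrix.isUnit_iff_isUnit_det _).mp hunit),
      Matrix.one_mulVec]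
  refine Eq.trans ?_ (congrFun h ⟨e, he⟩)
  rw [hK]
  simp only [incoherence, Matrix.mulVec, Matrix.of_apply]

theorem abs_sign_le_one (x : ℝ) : |Real.sign x| ≤ 1 := by
  rcases Real.sign_apply_eq x with h | h | h <;> simp [h]

theorem sign_add_of_abs_lt {x u : ℝ} (h : |u| < |x|) : Real.sign (x + u) = Real.sign x := by
  rw [abs_lt] at h
  rcases lt_trichotomy x 0 with hx | rfl | hx
  · rw [abs_of_neg hx] at h
    rw [Real.sign_of_neg hx, Real.sign_of_neg (by linarith)]
  · simp only [abs_zero] at h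
    linarith
  · rw [abs_of_pos hx] at h
    rw [Real.sign_of_pos hx, Real.sign_of_pos (by linarith)]

theorem abs_mulVec_le {S : Matrix (Fin p) (Fin p) ℝ} {c : ℝ}
    (hS : ∀ x, ‖WithLp.toLp 2 (S *ᵥ x)‖ ≤ c * ‖WithLp.toLp 2 x‖) (x : Fin p → ℝ) (i : Fin p) :
    |(S *ᵥ x) i| ≤ c * ‖WithLp.toLp 2 x‖ :=
  (abs_le_norm_toLp _ i).trans (hS x)

theorem mul_apply_eq_mulVec_row {S : Matrix (Fin p) (Fin p) ℝ} (hS : Sᵀ = S)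
    (V : Matrix (Fin p) (Fin p) ℝ) (i j : Fin p) : (V * S) i j = (S *ᵥ V i) j := by
  rw [Matrix.mul_apply, Matrix.mulVec, dotProduct]
  refine Finset.sum_congr rfl fun k _ => ?_
  rw [mul_comm, ← congrFun (congrFun hS k) j, Matrix.transpose_apply]

/-- Deterministic recovery: on the event that the sample covariance is uniformly accurate at scale
`x` in the relevant directions, the minimizer exists, is close to the truth and has the right
signs. -/
theorem isMinimizer_recovery {n : ℕ} (hn : n ≠ 0) (y : Fin n → Fin p → ℝ) (d : Fin p → ℝ)
    (M : Matrix (Fin p) (Fin p) ℝ) {a b T C₀ x l δ ρ : ℝ} (hM : Mᵀ = M) (hdet : IsUnit M.det)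
    (ha : 0 < a) (hb : 0 < b) (hT : 0 ≤ T) (hC₀ : 0 ≤ C₀) (hx : 0 ≤ x) (hx1 : x ≤ 1) (hl : 0 < l)
    (hlow : ∀ v, a * ‖WithLp.toLp 2 v‖ ^ 2 ≤ v ⬝ᵥ (M *ᵥ v))
    (hup : ∀ v, v ⬝ᵥ (M *ᵥ v) ≤ b * ‖WithLp.toLp 2 v‖ ^ 2)
    (hinc : ∀ e ∉ support M, |incoherence M e| ≤ δ)
    (hd : ∀ i, |d i - M i i| ≤ C₀ * x)
    (hdev : ∀ i j, |(sampleCov y - M⁻¹) i j| ≤ T * x)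
    (hdevM : ∀ i j, |(M * (sampleCov y - M⁻¹)) i j| ≤ T * x * b)
    (hdevU : ∀ i j, |((sampleCov y - M⁻¹) *ᵥ symMatrix (popDirection M) 0 j) i| ≤
      T * x * ‖WithLp.toLp 2 (symMatrix (popDirection M) 0 j)‖)
    (hsmall : (numEdges M : ℝ) * (4 * T * x) ≤ 2 / b / 2)
    (hρ : 2 / (2 / b) * (√(numEdges M : ℝ) * (2 * (T * b + C₀ * (a⁻¹ + T)) * x) +
      l * (numEdges M * (4 * T * x)) / (2 / b)) ≤ ρ)
    (hdual : 2 * (T * b + C₀ * (a⁻¹ + T)) * x + l * δ +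
      l * (√(numEdges M : ℝ) * (4 * T * x) / (2 / b)) +
      (4 / a + √(numEdges M : ℝ) * (4 * T * x)) * ρ < l)
    (hsig : ∀ e ∈ support M, l * (√(numEdges M : ℝ) / (2 / b)) + ρ < |offDiag M e|) :
    (∃ w, IsMinimizer y l d w) ∧ ∀ w, IsMinimizer y l d w →
      ‖WithLp.toLp 2 (w - offDiag M)‖ ≤ l * (√(numEdges M : ℝ) / (2 / b)) + ρ ∧
      ∀ e, Real.sign (w e) = Real.sign (offDiag M e) := by
  set S := sampleCov y with hS
  have hSt : Sᵀ = S := sampleCov_transpose y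
  have hIt : (M⁻¹)ᵀ = M⁻¹ := by rw [Matrix.transpose_nonsing_inv, hM]
  have hDt : (S - M⁻¹)ᵀ = S - M⁻¹ := by rw [Matrix.transpose_sub, hSt, hIt]
  have hinv := inv_bounds hM hdet ha hb hlow hup
  have hinvnorm : ∀ v, ‖WithLp.toLp 2 (M⁻¹ *ᵥ v)‖ ≤ a⁻¹ * ‖WithLp.toLp 2 v‖ :=
    norm_mulVec_le_of_le hIt (by positivity)
      (fun v => le_trans (by positivity) (hinv v).1) fun v => (hinv v).2
  -- M⁻¹ contributes b⁻¹ per row, and each edge lies in two rows.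
  have hcoer : ∀ v : Edge p → ℝ,
      2 / b * ‖WithLp.toLp 2 v‖ ^ 2 ≤ v ⬝ᵥ (Matrix.of (popHessian M⁻¹) *ᵥ v) := by
    intro v
    rw [popHessian_quadratic _ hIt]
    calc 2 / b * ‖WithLp.toLp 2 v‖ ^ 2
        = ∑ i, b⁻¹ * ‖WithLp.toLp 2 (symMatrix v 0 i)‖ ^ 2 := by
          rw [← Finset.mul_sum, sum_norm_sq_symMatrix]; ring
      _ ≤ _ := Finset.sum_le_sum fun i _ => (hinv _).1
  have hrow : ∀ (v : Edge p → ℝ) e,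
      |(Matrix.of (popHessian M⁻¹) *ᵥ v) e| ≤ 4 / a * ‖WithLp.toLp 2 v‖ := by
    intro v e
    have key : ∀ i j, |(symMatrix v 0 * M⁻¹) i j| ≤ a⁻¹ * (2 * ‖WithLp.toLp 2 v‖) := fun i j => by
      rw [mul_apply_eq_mulVec_row hIt]
      exact (abs_mulVec_le hinvnorm _ _).trans
        (mul_le_mul_of_nonneg_left (norm_symMatrix_row_le v i) (by positivity))
    rw [popHessian_mulVec _ hIt]
    refine (abs_add_le _ _).trans ((add_le_add (key _ _) (key _ _)).trans (le_of_eq ?_))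
    ring
  have hpos : ∀ v : Edge p → ℝ, v ≠ 0 → 0 < v ⬝ᵥ (Matrix.of (popHessian M⁻¹) *ᵥ v) := by
    intro v hv
    have : 0 < ‖WithLp.toLp 2 v‖ := by rw [norm_pos_iff]; simpa using hv
    exact lt_of_lt_of_le (by positivity) (hcoer v)
  have hEv : ∀ e, |((Matrix.of (popHessian S) - Matrix.of (popHessian M⁻¹)) *ᵥ
      popDirection M) e| ≤ 4 * T * x * ‖WithLp.toLp 2 (popDirection M)‖ := by
    intro e
    have key : ∀ i j, |(symMatrix (popDirection M) 0 * (S - M⁻¹)) i j| ≤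
        T * x * (2 * ‖WithLp.toLp 2 (popDirection M)‖) := fun i j => by
      rw [mul_apply_eq_mulVec_row hDt]
      exact (hdevU j i).trans
        (mul_le_mul_of_nonneg_left (norm_symMatrix_row_le _ i) (by positivity))
    rw [popHessian_sub, popHessian_mulVec _ hDt]
    refine (abs_add_le _ _).trans ((add_le_add (key _ _) (key _ _)).trans (le_of_eq ?_))
    ring
  have hE : ∀ e f, |(Matrix.of (popHessian S) - Matrix.of (popHessian M⁻¹)) e f| ≤
      4 * T * x := fun e f => by
    rw [popHessian_sub, Matrix.of_apply, mul_assoc]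
    exact abs_popHessian_le _ _ hdev e f
  have hg : ∀ e, |quadGrad S (symMatrix (offDiag M) d) e| ≤
      2 * (T * b + C₀ * (a⁻¹ + T)) * x := by
    have hIij : ∀ i j, |M⁻¹ i j| ≤ a⁻¹ := fun i j => by
      have h1 := abs_mulVec_le hinvnorm (Pi.single j 1) i
      simpa using h1
    have hSij : ∀ i j, |S i j| ≤ a⁻¹ + T := fun i j => by
      have h1 : S i j = M⁻¹ i j + (S - M⁻¹) i j := by simp
      rw [h1]
      refine (abs_add_le _ _).trans (add_le_add (hIij i j) ((hdev i j).trans ?_))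
      exact mul_le_of_le_one_right hT hx1
    have key : ∀ i j, i ≠ j → |(symMatrix (offDiag M) d * S) i j| ≤
        (T * b + C₀ * (a⁻¹ + T)) * x := by
      intro i j hij
      -- M M⁻¹ = 1 has no off-diagonal part, so only the sampling error and the diagonal error
      -- remain.
      have h1 : (symMatrix (offDiag M) d * S) i j =
          (M * (S - M⁻¹)) i j + (d i - M i i) * S i j := by
        rw [eq_symMatrix_add_diagonal hM, Matrix.add_mul, Matrix.add_apply, Matrix.mul_sub,
          Matrix.mul_nonsing_inv _ hdet, Matrix.sub_apply, Matrix.one_apply_ne hij,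
          Matrix.diagonal_mul, sub_zero]
      rw [h1]
      have h2 : |(d i - M i i) * S i j| ≤ C₀ * x * (a⁻¹ + T) := by
        rw [abs_mul]
        exact mul_le_mul (hd i) (hSij i j) (abs_nonneg _) (by positivity)
      refine (abs_add_le _ _).trans ((add_le_add (hdevM i j) h2).trans (le_of_eq ?_))
      ring
    intro e
    refine (abs_add_le _ _).trans
      ((add_le_add (key _ _ e.2.ne) (key _ _ e.2.ne')).trans (le_of_eq ?_))
    ring
  obtain ⟨hcurv, u, hu, huA, huAc, hun⟩ := exists_witness (support M)
    (Matrix.of (popHessian M⁻¹)) (Matrix.of (popHessian S))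
    (quadGrad S (symMatrix (offDiag M) d)) (fun e => Real.sign (offDiag M e)) (popDirection M)
    (2 / b) (4 / a) (2 * (T * b + C₀ * (a⁻¹ + T)) * x) (4 * T * x) δ l (by positivity)
    (by positivity) (by positivity) hl hcoer hrow hE hg (fun e => abs_sign_le_one _)
    (fun e he => popDirection_of_notMem he)
    (fun e he => by rw [popHessian_mulVec_popDirection, incoherence_of_mem hpos he])
    (fun e he => by rw [popHessian_mulVec_popDirection]; exact hinc e he)
    hEv hsmall ρ hρ hdual
  rw [← quadGrad_add _ hSt] at huA huAc
  have hθ : ∀ e, e ∉ support M → offDiag M e = 0 := fun e he => by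
    simpa [support] using he
  have hsign : ∀ e, Real.sign ((offDiag M + u) e) = Real.sign (offDiag M e) := by
    intro e
    by_cases he : e ∈ support M
    · exact sign_add_of_abs_lt
        (((abs_le_norm_toLp u e).trans hun).trans_lt (hsig e he))
    · rw [Pi.add_apply, hu e he, add_zero]
  -- The witness carries the true signs; `hsign` turns them into the signs of the candidate that KKT
  -- requires.
  have hlt := Qcon_lt_of_kkt hn y d (offDiag M + u) l (support M) hl hcurv
    (fun e he => by
      refine ⟨by rw [hsign]; exact huA e he, fun h0 => ?_⟩
      have h1 := hsign e
      rw [h0, Real.sign_zero, eq_comm, Real.sign_eq_zero_iff] at h1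
      simp [support, h1] at he)
    (fun e he => ⟨by rw [Pi.add_apply, hu e he, hθ e he, add_zero], huAc e he⟩)
  refine ⟨⟨offDiag M + u, fun v => ?_⟩, fun w hw => ?_⟩
  · by_cases hv : v = offDiag M + u
    · rw [hv]
    · exact (hlt v hv).le
  · have : w = offDiag M + u := by
      by_contra hne
      exact (hlt w hne).not_ge (hw _)
    subst this
    exact ⟨by rwa [add_sub_cancel_left], hsign⟩

end Deterministic

/-! ### High-probability events and asymptotic scaling. -/

section HighProb

variable {W : ℕ → Type*} [∀ n, MeasurableSpace (W n)] {μ : ∀ n, Measure (W n)}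
  {η : ℝ} {E F : ∀ n, Set (W n)}

theorem HighProb.mono [∀ n, IsProbabilityMeasure (μ n)] (hE : HighProb μ η E) (h : ∀ᶠ n in atTop, E n ⊆ F n) :
    HighProb μ η F := by
  refine IsBigO.trans (IsBigO.of_bound 1 ?_) hE
  filter_upwards [h] with n hn
  rw [one_mul, Real.norm_of_nonneg measureReal_nonneg, Real.norm_of_nonneg measureReal_nonneg]
  exact measureReal_mono (Set.compl_subset_compl.mpr hn)

theorem HighProb.inter (hE : HighProb μ η E) (hF : HighProb μ η F) :
    HighProb μ η fun n => E n ∩ F n := by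
  refine IsBigO.trans (IsBigO.of_bound 1 (Eventually.of_forall fun n => ?_)) (hE.add hF)
  rw [one_mul, Real.norm_of_nonneg measureReal_nonneg,
    Real.norm_of_nonneg (add_nonneg measureReal_nonneg measureReal_nonneg), Set.compl_inter]
  exact measureReal_union_le _ _

end HighProb

theorem lt_abs_offDiag_of_lt_minSignal_div {p : ℕ} {M : Matrix (Fin p) (Fin p) ℝ} {r C : ℝ}
    (hr : 0 < r) (hC : 0 ≤ C) (h : ENNReal.ofReal C < minSignal M / ENNReal.ofReal r) :
    ∀ e ∈ support M, C * r < |offDiag M e| := by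
  intro e he
  have h1 : minSignal M ≤ ENNReal.ofReal |offDiag M e| := iInf₂_le e he
  have h2 := (ENNReal.lt_div_iff_mul_lt (Or.inl (by simpa using hr))
    (Or.inl ENNReal.ofReal_ne_top)).mp h
  rw [← ENNReal.ofReal_mul hC] at h2
  exact (ENNReal.ofReal_lt_ofReal_iff_of_nonneg (by positivity)).mp (h2.trans_le h1)

/-- The asymptotic conditions make the error terms of the primal-dual witness construction
negligible. -/
theorem eventually_scaling {q x l : ℕ → ℝ}
    (hl : ∀ᶠ n in atTop, 0 < l n) (hx0 : Tendsto x atTop (𝓝 0))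
    (hqx : Tendsto (fun n => q n * x n) atTop (𝓝 0))
    (hsqx : Tendsto (fun n => √(q n) * x n) atTop (𝓝 0))
    (hxl : Tendsto (fun n => x n / l n) atTop (𝓝 0))
    (hqxl : Tendsto (fun n => √(q n) * x n / l n) atTop (𝓝 0)) {m T G R δ : ℝ} (hm : 0 < m)
    (hδ : δ < 1) :
    ∀ᶠ n in atTop, 0 < l n ∧ x n ≤ 1 ∧ q n * (4 * T * x n) ≤ m / 2 ∧
      2 / m * (√(q n) * (G * x n) + l n * (q n * (4 * T * x n)) / m) ≤ l n ∧
      G * x n + l n * δ + l n * (√(q n) * (4 * T * x n) / m) + (R + √(q n) * (4 * T * x n)) *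
        (2 / m * (√(q n) * (G * x n) + l n * (q n * (4 * T * x n)) / m)) < l n := by
  -- This is ρ / l. Below, `hD` is the dual feasibility bound divided by l, whose limit is δ < 1.
  have hτ : Tendsto (fun n => 2 / m * (G * (√(q n) * x n / l n) + 4 * T / m * (q n * x n)))
      atTop (𝓝 0) := by
    simpa using ((hqxl.const_mul G).add (hqx.const_mul (4 * T / m))).const_mul (2 / m)
  have hD : Tendsto (fun n => G * (x n / l n) + δ + 4 * T / m * (√(q n) * x n) +
      (R + 4 * T * (√(q n) * x n)) *
        (2 / m * (G * (√(q n) * x n / l n) + 4 * T / m * (q n * x n)))) atTop (𝓝 δ) := by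
    simpa using (((hxl.const_mul G).add_const δ).add (hsqx.const_mul (4 * T / m))).add
      (((hsqx.const_mul (4 * T)).const_add R).mul hτ)
  filter_upwards [hl, hx0.eventually (eventually_le_nhds one_pos),
    (hqx.const_mul (4 * T)).eventually
      (eventually_le_nhds (show 4 * T * 0 < m / 2 by simpa using hm)),
    hτ.eventually (eventually_le_nhds one_pos), hD.eventually (eventually_lt_nhds hδ)]
    with n h1 h2 h3 h4 h5
  have hρ : 2 / m * (√(q n) * (G * x n) + l n * (q n * (4 * T * x n)) / m) =
      l n * (2 / m * (G * (√(q n) * x n / l n) + 4 * T / m * (q n * x n))) := by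
    field_simp
  refine ⟨h1, h2, ?_, ?_, ?_⟩
  · linarith
  · rw [hρ]
    exact mul_le_of_le_one_right h1.le h4
  · rw [hρ]
    have h6 := mul_lt_mul_of_pos_left h5 h1
    rw [mul_one] at h6
    refine lt_of_eq_of_lt ?_ h6
    field_simp

end Concord

/-! ### Assembly of the theorem. -/

open Concord in
theorem theorem2 {W : ℕ → Type*} [∀ n, MeasurableSpace (W n)]
    (μ : ∀ n, Measure (W n)) [∀ n, IsProbabilityMeasure (μ n)]
    (p : ℕ → ℕ) (Ω : ∀ n, Matrix (Fin (p n)) (Fin (p n)) ℝ)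
    (Y : ∀ n, Fin n → W n → Fin (p n) → ℝ)
    (α : ∀ n, W n → Fin (p n) → ℝ) (l : ℕ → ℝ)
    (hmodel : Concord.IsModel μ p Ω Y)
    (hA0 : Concord.AccurateDiagonal μ p Ω α)
    (hA1 : Concord.BoundedEigenvalues p Ω)
    (hA2 : Concord.SubGaussian μ p Ω Y)
    (hA3 : Concord.Incoherent p Ω)
    (hp : ∃ κ : ℝ, 0 < κ ∧ (fun n => (p n : ℝ)) =O[atTop] fun n : ℕ => (n : ℝ) ^ κ)
    (hq : (fun n => (Concord.numEdges (Ω n) : ℝ)) =o[atTop]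
      fun n : ℕ => √((n : ℝ) / Real.log n))
    (hql : (fun n : ℕ => √((Concord.numEdges (Ω n) : ℝ) * Real.log n / n)) =o[atTop] l)
    (hl : Tendsto (fun n : ℕ => l n * √((n : ℝ) / Real.log n)) atTop atTop)
    (hs : Tendsto (fun n => Concord.minSignal (Ω n) /
      ENNReal.ofReal (√(Concord.numEdges (Ω n) : ℝ) * l n)) atTop (𝓝 ⊤))
    (hql0 : Tendsto (fun n => √(Concord.numEdges (Ω n) : ℝ) * l n) atTop (𝓝 0)) :
    ∃ C : ℝ, 0 < C ∧ ∀ η : ℝ, 0 < η →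
      Concord.HighProb μ η fun n => {ξ |
        (∃ w, Concord.IsMinimizer (fun k => Y n k ξ) (l n) (α n ξ) w) ∧
        ∀ w, Concord.IsMinimizer (fun k => Y n k ξ) (l n) (α n ξ) w →
          ‖WithLp.toLp 2 (w - Concord.offDiag (Ω n))‖ ≤
            C * (√(Concord.numEdges (Ω n) : ℝ) * l n) ∧
          ∀ e, Real.sign (w e) = Real.sign (Concord.offDiag (Ω n) e)} := by
  obtain ⟨a, b', ha, hspec⟩ := hA1
  obtain ⟨⟨c, hc, hsub⟩, -⟩ := hA2
  obtain ⟨δ, hδ, hinc⟩ := hA3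
  obtain ⟨κ, hκ, hpκ⟩ := hp
  -- If all dimensions are zero, the spectra are empty and b' need not be positive.
  set b := max b' 1 with hb_def
  have hb : 0 < b := lt_of_lt_of_le one_pos (le_max_right _ _)
  have hherm : ∀ n, 1 ≤ n → (Ω n)ᵀ = Ω n := fun n hn => by
    simpa using (hmodel.posDef n hn).isHermitian.eq
  have hdet : ∀ n, 1 ≤ n → IsUnit (Ω n).det := fun n hn =>
    (hmodel.posDef n hn).det_pos.ne'.isUnit
  have hbd : ∀ n, 1 ≤ n → ∀ v, a * ‖WithLp.toLp 2 v‖ ^ 2 ≤ v ⬝ᵥ (Ω n *ᵥ v) ∧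
      v ⬝ᵥ (Ω n *ᵥ v) ≤ b * ‖WithLp.toLp 2 v‖ ^ 2 := fun n hn =>
    spectrum_bounds (hmodel.posDef n hn).isHermitian fun t ht =>
      ⟨(hspec n hn t ht).1, (hspec n hn t ht).2.trans (le_max_left _ _)⟩
  have hsub' : ∀ n (k : Fin n) (x : Fin (p n) → ℝ),
      Integrable (fun ξ => Real.exp (x ⬝ᵥ Y n k ξ)) (μ n) ∧
      ∫ ξ, Real.exp (x ⬝ᵥ Y n k ξ) ∂(μ n) ≤ Real.exp (c * a⁻¹ * ‖WithLp.toLp 2 x‖ ^ 2) := by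
    intro n k x
    have hn : 1 ≤ n := k.pos
    refine ⟨(hsub n k x).1, (hsub n k x).2.trans (Real.exp_le_exp.mpr ?_)⟩
    rw [mul_assoc]
    exact mul_le_mul_of_nonneg_left (inv_bounds (hherm n hn) (hdet n hn) ha hb
      (fun v => (hbd n hn v).1) (fun v => (hbd n hn v).2) x).2 hc.le
  have hnormrow : ∀ n, 1 ≤ n → ∀ i, ‖WithLp.toLp 2 (Ω n i)‖ ≤ b := by
    intro n hn i
    have h := norm_mulVec_le_of_le (hherm n hn) hb.le
      (fun v => le_trans (by positivity) (hbd n hn v).1) (fun v => (hbd n hn v).2) (Pi.single i 1)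
    have h1 : Ω n *ᵥ Pi.single i 1 = Ω n i := by
      ext j
      rw [Matrix.mulVec_single_one, Matrix.col_apply]
      exact congrFun (congrFun (hherm n hn) i) j
    have h2 : ‖WithLp.toLp 2 (Pi.single i (1 : ℝ) : Fin (p n) → ℝ)‖ = 1 := by
      simp
    rwa [h1, h2, mul_one] at h
  have hcard : (fun n => (Fintype.card (Fin (p n) × Fin (p n)) : ℝ)) =O[atTop]
      fun n : ℕ => (n : ℝ) ^ (κ + κ) := by
    refine ((hpκ.mul hpκ).congr_left fun n => by simp).trans (IsBigO.of_bound 1 ?_)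
    filter_upwards [eventually_ge_atTop 1] with n hn
    rw [Real.rpow_add (by exact_mod_cast hn), one_mul]
  set q : ℕ → ℝ := fun n => (numEdges (Ω n) : ℝ) with hq_def
  set x : ℕ → ℝ := fun n => √(Real.log n / n) with hx_def
  have hx : ∀ n, 0 ≤ x n := fun n => Real.sqrt_nonneg _
  have hq0 : ∀ n, 0 ≤ q n := fun n => Nat.cast_nonneg _
  have hxinv : ∀ n : ℕ, √((n : ℝ) / Real.log n) = (x n)⁻¹ := fun n => by
    rw [hx_def, ← Real.sqrt_inv, inv_div]
  simp only [hxinv] at hq hl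
  have hlpos : ∀ᶠ n in atTop, 0 < l n := by
    filter_upwards [hl.eventually (eventually_gt_atTop 0)] with n hn
    exact pos_of_mul_pos_left hn (inv_nonneg.mpr (hx n))
  have hqx : Tendsto (fun n => q n * x n) atTop (𝓝 0) := by
    simpa [div_inv_eq_mul] using hq.tendsto_div_nhds_zero
  have hsqx : Tendsto (fun n => √(q n) * x n) atTop (𝓝 0) := by
    refine squeeze_zero (fun n => mul_nonneg (Real.sqrt_nonneg _) (hx n)) (fun n => ?_) hqx
    -- √q ≤ q because q is a natural number.
    refine mul_le_mul_of_nonneg_right ?_ (hx n)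
    rw [Real.sqrt_le_left (hq0 n)]
    rcases Nat.eq_zero_or_pos (numEdges (Ω n)) with h | h
    · simp [hq_def, h]
    · have : (1 : ℝ) ≤ q n := Nat.one_le_cast.mpr h
      nlinarith
  have hxl : Tendsto (fun n => x n / l n) atTop (𝓝 0) := by
    refine hl.inv_tendsto_atTop.congr fun n => ?_
    simp [div_eq_mul_inv, mul_comm]
  have hqxl : Tendsto (fun n => √(q n) * x n / l n) atTop (𝓝 0) := by
    refine hql.tendsto_div_nhds_zero.congr fun n => ?_
    rw [mul_div_assoc, Real.sqrt_mul (hq0 n)]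
  -- The population direction contributes (2/b)⁻¹, the remainder 1. Neither depends on η, which
  -- affects only C₀, T and the threshold for n.
  refine ⟨(2 / b)⁻¹ + 1, by positivity, fun η hη => ?_⟩
  obtain ⟨C₀, hC₀, hE₀⟩ := hA0 η hη
  have hv : 0 < c * a⁻¹ := by positivity
  -- Three deterministic families of directions control the entries of S - Ω⁻¹, the gradient at the
  -- truth, and the Hessian error along the population direction.
  obtain ⟨T₁, hT₁, hE₁⟩ := highProb_sampleCov_dev hmodel hv hsub'
    (J := fun n => Fin (p n) × Fin (p n)) (fun n ij => Pi.single ij.1 1)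
    (fun n ij => Pi.single ij.2 1) hcard η
  obtain ⟨T₂, hT₂, hE₂⟩ := highProb_sampleCov_dev hmodel hv hsub'
    (J := fun n => Fin (p n) × Fin (p n)) (fun n ij => Ω n ij.1)
    (fun n ij => Pi.single ij.2 1) hcard η
  obtain ⟨T₃, hT₃, hE₃⟩ := highProb_sampleCov_dev hmodel hv hsub'
    (J := fun n => Fin (p n) × Fin (p n)) (fun n ij => Pi.single ij.1 1)
    (fun n ij => symMatrix (popDirection (Ω n)) 0 ij.2) hcard η
  set T := T₁ + T₂ + T₃ with hT_def
  have hT : 0 < T := by positivity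
  refine (hE₀.inter (hE₁.inter (hE₂.inter hE₃))).mono ?_
  filter_upwards [eventually_ge_atTop 1, eventually_scaling hlpos
    tendsto_sqrt_log_div_atTop hqx hsqx hxl hqxl (m := 2 / b) (T := T)
    (G := 2 * (T * b + C₀ * (a⁻¹ + T))) (R := 4 / a) (by positivity) hδ,
    hs.eventually (lt_mem_nhds (ENNReal.ofReal_lt_top (r := (2 / b)⁻¹ + 1)))]
    with n hn hscale hsn
  obtain ⟨hln, hx1, hsmall, hρl, hdual⟩ := hscale
  rintro ξ ⟨h₀, h₁, h₂, h₃⟩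
  simp only [Set.mem_ofPred_eq] at h₀ h₁ h₂ h₃ ⊢
  set ρ := 2 / (2 / b) * (√(q n) * (2 * (T * b + C₀ * (a⁻¹ + T)) * x n) +
    l n * (q n * (4 * T * x n)) / (2 / b)) with hρ_def
  have hsingle : ∀ i, ‖WithLp.toLp 2 (Pi.single i (1 : ℝ) : Fin (p n) → ℝ)‖ = 1 := by simp
  -- The scaling gives ρ ≤ l, which suffices when q ≥ 1; for q = 0, ρ itself vanishes.
  have hρq : ρ ≤ √(q n) * l n := by
    rcases Nat.eq_zero_or_pos (numEdges (Ω n)) with h | h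
    · have : q n = 0 := by simp [hq_def, h]
      rw [hρ_def, this]
      simp
    · have h1 : (1 : ℝ) ≤ q n := Nat.one_le_cast.mpr h
      have h2 : 1 ≤ √(q n) := Real.one_le_sqrt.mpr h1
      exact hρl.trans (le_mul_of_one_le_left hln.le h2)
  have hbound : l n * (√(q n) / (2 / b)) + ρ ≤ ((2 / b)⁻¹ + 1) * (√(q n) * l n) := by
    have : l n * (√(q n) / (2 / b)) = (2 / b)⁻¹ * (√(q n) * l n) := by ring
    rw [this, add_mul, one_mul]
    linarith
  have hxn := hx n
  have hT₁T : T₁ * x n ≤ T * x n := mul_le_mul_of_nonneg_right (by linarith) hxn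
  have hT₂T : T₂ * x n ≤ T * x n := mul_le_mul_of_nonneg_right (by linarith) hxn
  have hT₃T : T₃ * x n ≤ T * x n := mul_le_mul_of_nonneg_right (by linarith) hxn
  have := isMinimizer_recovery (ρ := ρ) (Nat.one_le_iff_ne_zero.mp hn) (fun k => Y n k ξ)
    (α n ξ) (Ω n) (hherm n hn) (hdet n hn) ha hb hT.le hC₀.le hxn hx1 hln (fun v => (hbd n hn v).1)
    (fun v => (hbd n hn v).2) (hinc n hn) h₀
    (fun i j => by
      have h := h₁ (i, j)
      rw [hsingle, hsingle, mul_one, mul_one] at h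
      refine le_trans (le_of_eq ?_) (h.trans hT₁T)
      simp)
    (fun i j => by
      have h := h₂ (i, j)
      rw [hsingle, mul_one] at h
      refine le_trans (le_of_eq ?_) (h.trans
        (mul_le_mul hT₂T (hnormrow n hn i) (norm_nonneg _) (by positivity)))
      simp only [Matrix.mulVec_single_one]
      rfl)
    (fun i j => by
      have h := h₃ (i, j)
      rw [hsingle, one_mul] at h
      refine le_trans (le_of_eq ?_) (h.trans
        (mul_le_mul_of_nonneg_right hT₃T (norm_nonneg _)))
      simp)
    hsmall le_rfl hdual
    (fun e he => by
      have hqpos : 0 < q n := Nat.cast_pos.mpr (Finset.card_pos.mpr ⟨e, he⟩)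
      exact hbound.trans_lt (lt_abs_offDiag_of_lt_minSignal_div
        (by positivity) (by positivity) hsn e he))
  exact ⟨this.1, fun w hw => ⟨(this.2 w hw).1.trans hbound, (this.2 w hw).2⟩⟩
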